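/- **Setting.** Let $\mathscr M$ be a separable real Hilbert space and $\mu=\mathcal N(0,\mathcal C)$ a centered Gaussian measure on $\mathscr M$ with covariance operator $\mathcal C$. Let $\mathscr H_\mu\hookrightarrow\mathscr M$ be its Cameron–Martin space (inner product $\langle\mathcal C^{-1}\cdot,\cdot\rangle$). For $h\in\mathscr H_\mu$ we also write $\langle\cdot,h\rangle_{\mathscr H_\mu}$ for the ($\mu$-a.e. defined) measurable linear extension of this functional to $\mathscr M$, i.e. the element of the $L^2_\mu$-closure of the continuous linear functionals that corresponds to $h$. Let $\mathscr Y=\mathbb R^{d_y}$ with inner product $x^T\boldsymbol C_n^{-1}y$, where $\boldsymbol C_n$ is positive definite. Let $\mathcal G\in H^1_\mu(\mathscr M;\mathscr Y)$, that is: $\mathcal G\in L^2_\mu(\mathscr M;\mathscr Y)$; for each $h\in\mathscr H_\mu$ some $\mu$-version of $\mathcal G$ is locally absolutely continuous along all lines in direction $h$; and $\mathcal G$ has a stochastic derivative $D\mathcal G\in L^2_\mu(\mathscr M;\mathrm{HS}(\mathscr H_\mu,\mathscr Y))$, meaning that for each $h\in\mathscr H_\mu$, $t^{-1}(\mathcal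 G(m+th)-\mathcal G(m))\to D\mathcal G(m)h$ as $t\to0$ for $\mu$-a.e. $m$. Put $\mathcal H(m)=D\mathcal G(m)^*D\mathcal G(m)$ (the prior-preconditioned Gauss–Newton Hessian, ppGNH), an operator on $\mathscr H_\mu$; let $\mathbb E[\mathcal H]=\mathbb E_{M\sim\mu}[\mathcal H(M)]$ be its expectation and $\widehat{\mathcal H}=\frac1n\sum_{i=1}^n\mathcal H(m_i)$ its estimate from sample points $m_1,\dots,m_n\in\mathscr M$, $n\ge1$ (the bound holds for every realization of the sample). Let $(\lambda_j,\psi_j)_j$ and $(\widehat\lambda_j,\widehat\psi_j)_j$ be full systems of $\mathscr H_\mu$-orthonormal eigenpairs of $\mathbb E[\mathcal H]$ and of $\widehat{\mathcal H}$ with decreasing eigenvalues, where *full* means that the operator vanishes on the orthogonal complement of the listed eigenvectors. The systems are indexed by $j\ge1$; finite systems are also allowed, with eigenvalues continued by $0$. Let $r\ge0$ be an integer not exceeding the number of the $\widehat\psi_j$, and put $\widehat\Psi_r z=\sum_{j\le r}z_j\widehat\psi_j$ for $z\in\mathbb R^r$ and $\widehat\Psi_r^*m=(\langle m,\widehat\psi_j\rangle_{\mathscr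 H_\mu})_{j\le r}$ for $m\in\mathscr M$. Let $\boldsymbol V:\mathbb R^{d_y}\to\mathscr Y$ be the isometry given by an orthonormal basis of $\mathscr Y$. Let $\boldsymbol f_{NN}:\mathbb R^r\times\mathbb R^{d_w}\to\mathbb R^{d_y}$ and a weight $\boldsymbol w\in\mathbb R^{d_w}$ be such that $\boldsymbol f_{NN}(\cdot,\boldsymbol w)$ is Borel measurable, and let $\widetilde{\mathcal G}(m;\boldsymbol w)=\boldsymbol V\boldsymbol f_{NN}(\widehat\Psi_r^*m,\boldsymbol w)$ be the reduced-basis surrogate. Let $\mathcal G_r$ be the optimal reduced mapping $$\mathcal G_r(m)=\mathbb E_{M\sim\mu}\big[\mathcal G(\widehat\Psi_r\widehat\Psi_r^*m+(I-\widehat\Psi_r\widehat\Psi_r^*)M)\big],\qquad\text{so that}\qquad \mathcal G_r(\widehat\Psi_rz)=\mathbb E_{M\sim\mu}\big[\mathcal G(\widehat\Psi_rz+(I-\widehat\Psi_r\widehat\Psi_r^*)M)\big].$$ **Claim.** The expectation $\mathbb E[\mathcal H]$ exists as a Bochner integral in $B(\mathscr H_\mu)$, $\sum_j\lambda_j<\infty$,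 the expectation defining $\mathcal G_r(\widehat\Psi_r z)$ exists for $\mathcal N(0,I_r)$-a.e. $z\in\mathbb R^r$, and $$\big\|\mathcal G-\widetilde{\mathcal G}(\cdot;\boldsymbol w)\big\|_{L^2_\mu(\mathscr M;\mathscr Y)}\le\big\|\boldsymbol f_{NN}(\cdot,\boldsymbol w)-\boldsymbol V^*\circ\mathcal G_r\circ\widehat\Psi_r\big\|_{L^2_{\mathcal N(0,I_r)}(\mathbb R^r;\mathbb R^{d_y})}+\Big(\sum_{j=r+1}^\infty\lambda_j+2r\big\|\mathbb E[\mathcal H]-\widehat{\mathcal H}\big\|_{B(\mathscr H_\mu)}\Big)^{1/2},$$ where the norms of $L^2$ type may take the value $+\infty$. -/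

import Mathlib

open MeasureTheory ProbabilityTheory Filter Topology
open scoped ENNReal Matrix

noncomputable section

/-! ### The observable space -/

/-- The observable Cameron--Martin space `𝒴`: the vector space `ℝ^d` with the inner product
`⟨x, y⟩ = xᵀ Cₙ⁻¹ y` given by the inverse of the (positive definite) noise covariance `Cₙ`. -/
structure ObsSpace {d : ℕ} (Cn : Matrix (Fin d) (Fin d) ℝ) (hCn : Cn.PosDef) where
  /-- the underlying vector of `ℝ^d` -/
  coords : Fin d → ℝ

namespace ObsSpace

variable {d : ℕ} {Cn : Matrix (Fin d) (Fin d) ℝ} {hCn : Cn.PosDef}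

/-- `ObsSpace Cn hCn` is `ℝ^d` as a set. -/
def equiv (Cn : Matrix (Fin d) (Fin d) ℝ) (hCn : Cn.PosDef) :
    ObsSpace Cn hCn ≃ (Fin d → ℝ) where
  toFun := coords
  invFun := mk
  left_inv _ := rfl
  right_inv _ := rfl

instance : AddCommGroup (ObsSpace Cn hCn) := (equiv Cn hCn).addCommGroup

instance : Module ℝ (ObsSpace Cn hCn) := (equiv Cn hCn).module ℝ

/-- `ObsSpace Cn hCn` is `ℝ^d` as a vector space. -/
def linearEquiv (Cn : Matrix (Fin d) (Fin d) ℝ) (hCn : Cn.PosDef) :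
    ObsSpace Cn hCn ≃ₗ[ℝ] (Fin d → ℝ) := (equiv Cn hCn).linearEquiv ℝ

@[simp] theorem coords_add (x y : ObsSpace Cn hCn) : (x + y).coords = x.coords + y.coords := rfl

@[simp] theorem coords_smul (c : ℝ) (x : ObsSpace Cn hCn) : (c • x).coords = c • x.coords := rfl

/-- The inner product weighted by `Cₙ⁻¹`. -/
instance innerCore : InnerProductSpace.Core ℝ (ObsSpace Cn hCn) where
  inner x y := x.coords ⬝ᵥ (Cn⁻¹ *ᵥ y.coords)
  conj_inner_symm x y := by
    have h : (Cn⁻¹)ᵀ = Cn⁻¹ := by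
      simpa [Matrix.IsHermitian, Matrix.conjTranspose_eq_transpose_of_trivial] using
        hCn.inv.isHermitian
    simp only [conj_trivial]
    rw [Matrix.dotProduct_mulVec, ← Matrix.mulVec_transpose, h, dotProduct_comm]
  re_inner_nonneg x := by
    simpa using hCn.inv.posSemidef.dotProduct_mulVec_nonneg x.coords
  add_left x y z := by simp [add_dotProduct]
  smul_left x y r := by simp [smul_dotProduct]
  definite x hx := by
    by_contra h
    have h0 : x.coords ≠ 0 := fun h' => h ((linearEquiv Cn hCn).map_eq_zero_iff.mp h')
    have := hCn.inv.dotProduct_mulVec_pos h0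
    simp only [star_trivial] at this
    exact absurd hx this.ne'

instance : NormedAddCommGroup (ObsSpace Cn hCn) :=
  InnerProductSpace.Core.toNormedAddCommGroup (𝕜 := ℝ)

instance : InnerProductSpace ℝ (ObsSpace Cn hCn) :=
  InnerProductSpace.ofCore innerCore.toCore

instance : FiniteDimensional ℝ (ObsSpace Cn hCn) :=
  (linearEquiv Cn hCn).symm.finiteDimensional

instance : CompleteSpace (ObsSpace Cn hCn) := FiniteDimensional.complete ℝ _

end ObsSpace

/-! ### The Cameron--Martin space of a centered Gaussian measure -/

section CameronMartin

variable {M : Type*} [NormedAddCommGroup M] [InnerProductSpace ℝ M] [CompleteSpace M]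
  [SecondCountableTopology M] [MeasurableSpace M] [BorelSpace M]

/-- The closure in `L²(μ)` of the continuous linear functionals `⟨k, ·⟩` on `M`. -/
def cmSubmodule (μ : Measure M) : Submodule ℝ (Lp ℝ 2 μ) :=
  (LinearMap.range (StrongDual.toLp (𝕜 := ℝ) (E := M) μ 2).toLinearMap).topologicalClosure

/-- The Cameron--Martin space `H_μ` of a centered Gaussian measure `μ = N(0, C)` on `M`, in its
isometric model as the closure in `L²(μ)` of the continuous linear functionals `⟨k, ·⟩`.
Since `‖⟨k, ·⟩‖²_{L²(μ)} = ⟨C k, k⟩`, this is the completion of the range of `C` for the inner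
product `⟨C⁻¹ ·, ·⟩`, where `⟨k, ·⟩` stands for `C k`; see `cmEmb` for the embedding into `M`. -/
def CMSpace (μ : Measure M) : Type _ := cmSubmodule μ

instance (μ : Measure M) : NormedAddCommGroup (CMSpace μ) :=
  inferInstanceAs (NormedAddCommGroup (cmSubmodule μ))

instance (μ : Measure M) : InnerProductSpace ℝ (CMSpace μ) :=
  inferInstanceAs (InnerProductSpace ℝ (cmSubmodule μ))

instance (μ : Measure M) : CompleteSpace (CMSpace μ) :=
  inferInstanceAs (CompleteSpace
    (LinearMap.range (StrongDual.toLp (𝕜 := ℝ) (E := M) μ 2).toLinearMap).topologicalClosure)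

/-- The measurable linear extension to `M` of the functional `⟨·, h⟩_{H_μ}` on `H_μ`; it is defined
up to `μ`-null sets. For `h = C k` it is `⟨k, ·⟩`. -/
def cmExt (μ : Measure M) (h : CMSpace μ) : M → ℝ :=
  ((show cmSubmodule μ from h) : Lp ℝ 2 μ)

/-- The embedding `H_μ ↪ M`, `h ↦ ∫ h(m) m μ(dm)`, where `h` is viewed as an element of `L²(μ)`.
It sends `⟨k, ·⟩` to `C k`. -/
def cmEmb (μ : Measure M) (h : CMSpace μ) : M :=
  ∫ m, cmExt μ h m • m ∂μ

/-- The encoder `Ψ_r^*`, extended to `M`: `m ↦ (⟨m, ψ_j⟩_{H_μ})_j`. -/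
def encoder (μ : Measure M) {r : ℕ} (ψ : Fin r → CMSpace μ) (m : M) : EuclideanSpace ℝ (Fin r) :=
  WithLp.toLp 2 fun j => cmExt μ (ψ j) m

/-- The decoder `Ψ_r : ℝ^r → H_μ ⊆ M`, `z ↦ ∑_j z_j ψ_j`. -/
def decoder (μ : Measure M) {r : ℕ} (ψ : Fin r → CMSpace μ) (z : EuclideanSpace ℝ (Fin r)) : M :=
  cmEmb μ (∑ j, z j • ψ j)

/-! ### Stochastic derivative and the Gaussian Sobolev space -/

variable {Y : Type*} [NormedAddCommGroup Y] [InnerProductSpace ℝ Y]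

/-- The squared Hilbert--Schmidt norm `∑_i ‖T e_i‖²` over a Hilbert basis `(e_i)` of the domain
(the value does not depend on the basis). -/
def hsNormSq {H : Type*} [NormedAddCommGroup H] [InnerProductSpace ℝ H] [CompleteSpace H]
    (T : H →L[ℝ] Y) : ℝ≥0∞ :=
  ∑' i : (exists_hilbertBasis ℝ H).choose,
    ‖T ((exists_hilbertBasis ℝ H).choose_spec.choose i)‖ₑ ^ 2

/-- `D` is a stochastic derivative of `G`: in every Cameron--Martin direction `h`, the difference
quotients of `G` converge to `D(m) h` for `μ`-almost every `m`. -/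
def IsStochasticDeriv (μ : Measure M) (G : M → Y) (D : M → CMSpace μ →L[ℝ] Y) : Prop :=
  ∀ h : CMSpace μ, ∀ᵐ m ∂μ,
    Tendsto (fun t : ℝ => t⁻¹ • (G (m + t • cmEmb μ h) - G m)) (𝓝[≠] 0) (𝓝 (D m h))

/-- Ray absolute continuity: for every Cameron--Martin direction `h`, some `μ`-version of `G` is
locally absolutely continuous along all lines in the direction `h`. -/
def RayAbsolutelyContinuous (μ : Measure M) (G : M → Y) : Prop :=
  ∀ h : CMSpace μ, ∃ G' : M → Y, G' =ᵐ[μ] G ∧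
    ∀ m : M, ∀ a b : ℝ, AbsolutelyContinuousOnInterval (fun t : ℝ => G' (m + t • cmEmb μ h)) a b

/-- `G ∈ H¹_μ(M; Y)` with stochastic derivative `D`: `G` is in `L²_μ(M; Y)` and ray absolutely
continuous, and it has the stochastic derivative `D`, which is in `L²_μ(M; HS(H_μ, Y))`. -/
structure MemH1 (μ : Measure M) (G : M → Y) (D : M → CMSpace μ →L[ℝ] Y) : Prop where
  memLp : MemLp G 2 μ
  rayAC : RayAbsolutelyContinuous μ G
  deriv : IsStochasticDeriv μ G D
  aestronglyMeasurable_deriv : AEStronglyMeasurable D μ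
  lintegral_hsNormSq_lt_top : ∫⁻ m, hsNormSq (D m) ∂μ < ∞

/-! ### The prior-preconditioned Gauss--Newton Hessian -/

/-- The ppGNH `ℋ(m) = D(m)^* D(m)`, an operator on `H_μ`. -/
def ppGNH [CompleteSpace Y] {μ : Measure M} (D : M → CMSpace μ →L[ℝ] Y) (m : M) :
    CMSpace μ →L[ℝ] CMSpace μ :=
  ContinuousLinearMap.adjoint (D m) ∘L D m

/-- The expected ppGNH `𝔼_{M ∼ μ}[ℋ(M)]`. -/
def expectedPPGNH [CompleteSpace Y] (μ : Measure M) (D : M → CMSpace μ →L[ℝ] Y) :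
    CMSpace μ →L[ℝ] CMSpace μ :=
  ∫ m, ppGNH D m ∂μ

/-- The sample estimate `(1/n) ∑_i ℋ(m_i)` of the expected ppGNH. -/
def samplePPGNH [CompleteSpace Y] {μ : Measure M} (D : M → CMSpace μ →L[ℝ] Y) {n : ℕ}
    (x : Fin n → M) : CMSpace μ →L[ℝ] CMSpace μ :=
  (n : ℝ)⁻¹ • ∑ i, ppGNH D (x i)

/-- `(lam j, ψ j)`, `j < N`, is a full system of orthonormal eigenpairs of `T` with decreasing
nonnegative eigenvalues: every nonzero eigenvalue is listed with its multiplicity, i.e. `T` vanishes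
on the orthogonal complement of the `ψ j`. If the number `N ≤ ∞` of the eigenpairs is finite (which
happens only if `T` has finite rank), the sequence `lam` is continued by `0`. -/
structure IsEigensystem {H : Type*} [NormedAddCommGroup H] [InnerProductSpace ℝ H]
    (T : H →L[ℝ] H) (N : ℕ∞) (lam : ℕ → ℝ) (ψ : ℕ → H) : Prop where
  nonneg : ∀ j, 0 ≤ lam j
  antitone : Antitone lam
  eigen : ∀ j : ℕ, (j : ℕ∞) < N → T (ψ j) = lam j • ψ j
  orthonormal : Orthonormal ℝ (fun j : {j : ℕ // (j : ℕ∞) < N} => ψ j)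
  complete : ∀ h : H, (∀ j : ℕ, (j : ℕ∞) < N → inner ℝ (ψ j) h = 0) → T h = 0
  eq_zero : ∀ j : ℕ, N ≤ (j : ℕ∞) → lam j = 0

/-! ### The reduced mapping and the surrogate -/

/-- The argument `Ψ_r z + (I - Ψ_r Ψ_r^*) m` at which `G` is averaged. -/
def mixArg (μ : Measure M) {r : ℕ} (ψ : Fin r → CMSpace μ) (z : EuclideanSpace ℝ (Fin r))
    (m : M) : M :=
  decoder μ ψ z + (m - decoder μ ψ (encoder μ ψ m))

/-- The optimal reduced mapping in reduced coordinates, `G_r ∘ Ψ_r : ℝ^r → Y`. With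
`G_r(m) = 𝔼_{M ∼ μ}[G(Ψ_r Ψ_r^* m + (I - Ψ_r Ψ_r^*) M)]` and `Ψ_r^* Ψ_r = I_r`, it is
`z ↦ 𝔼_{M ∼ μ}[G(Ψ_r z + (I - Ψ_r Ψ_r^*) M)]`. -/
def reducedMap (μ : Measure M) (G : M → Y) {r : ℕ} (ψ : Fin r → CMSpace μ)
    (z : EuclideanSpace ℝ (Fin r)) : Y :=
  ∫ m, G (mixArg μ ψ z m) ∂μ

/-- The reduced basis surrogate `V ∘ f ∘ Ψ_r^*`; here `V.repr.symm : ℝ^d → Y` sends a vector to the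
linear combination of the orthonormal basis `V` with these coefficients. -/
def surrogate (μ : Measure M) {r d : ℕ} (ψ : Fin r → CMSpace μ)
    (V : OrthonormalBasis (Fin d) ℝ Y)
    (f : EuclideanSpace ℝ (Fin r) → EuclideanSpace ℝ (Fin d)) (m : M) : Y :=
  V.repr.symm (f (encoder μ ψ m))

end CameronMartin

end

noncomputable section

set_option linter.unusedSectionVars false

/-! Insert the optimal reduced mapping, composed with the encoder, between the map and the
surrogate. The encoder pushes the prior to the standard Gaussian (`map_encoder`), so one term of the
triangle inequality is the network error in reduced coordinates. The other, the ridge error, rests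
on two facts: a Poincaré inequality bounding its square by the trace of the expected ppGNH on the
orthogonal complement of the reduced basis (`MemH1.lintegral_sub_reducedMap_le`), and a perturbation
bound for that trace (`sum_inner_complement_le`).

The Poincaré inequality is built up from dimension one, where the variance is half the mean of |f(x)
- f(y)|² over independent x, y. Cauchy-Schwarz and Tonelli turn this mean into an integral of |f'|²
against a kernel that equals twice the Gaussian density (`gaussian_poincare`). For a unit
Cameron-Martin direction e, the coordinate along e is independent of the residual, so the
one-dimensional inequality on lines bounds the distance of F from `cosOrth μ e`, the closed span of
the cosines in directions orthogonal to e, by the L² norm of the derivative along e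
(`sq_norm_sub_starProjection_cosOrth_le`).

For orthonormal directions the product of the projections has a squared error at most the sum of the
individual ones (`exists_finset_average`). On cosines the product is explicit, and along an
orthonormal basis of the complement it converges to a function of the encoder. Cosines are total in
L², so F is within the square root of the summed bound of the functions of the encoder, among which
the reduced mapping is the best approximation (`lintegral_sub_reducedMap_le`).

For the trace, let T be the expected ppGNH and S its estimate. The trace of T off the leading r
eigenvectors of S is at most the full trace minus the part on these eigenvectors. Ky Fan's principle
for S compares that part with the leading eigenvalues of T; exchanging T for S and back costs r‖T -
S‖ each time, whence the factor 2r. -/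

/-! ### The Gaussian Poincaré inequality on the line -/

theorem hasDerivAt_gaussianPDFReal_std (x : ℝ) :
    HasDerivAt (gaussianPDFReal 0 1) (-(x * gaussianPDFReal 0 1 x)) x := by
  have h : HasDerivAt (fun y : ℝ => -(y - 0) ^ 2 / (2 * ((1 : NNReal) : ℝ))) (-x) x := by
    have := (((hasDerivAt_id' x).sub_const 0).fun_pow 2).fun_neg.div_const (2 * ((1 : NNReal) : ℝ))
    refine this.congr_deriv ?_
    norm_num
    ring
  have h2 := h.exp.const_mul ((√(2 * Real.pi * ((1 : NNReal) : ℝ)))⁻¹)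
  refine h2.congr_deriv ?_
  rw [gaussianPDFReal_def]
  ring

theorem tendsto_gaussianPDFReal_std_atTop :
    Tendsto (gaussianPDFReal 0 1) atTop (𝓝 0) := by
  have h : Tendsto (fun x : ℝ => -(x - 0) ^ 2 / (2 * ((1 : NNReal) : ℝ))) atTop atBot := by
    have : Tendsto (fun x : ℝ => x ^ 2 * (-1 / 2)) atTop atBot :=
      (tendsto_pow_atTop two_ne_zero).atTop_mul_const_of_neg (by norm_num)
    refine this.congr fun x => ?_
    simp; ring
  have := (Real.tendsto_exp_atBot.comp h).const_mul ((√(2 * Real.pi * ((1 : NNReal) : ℝ)))⁻¹)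
  rw [mul_zero] at this
  exact this

theorem integrable_id_mul_gaussianPDFReal_std :
    Integrable (fun x : ℝ => x * gaussianPDFReal 0 1 x) := by
  have h : Integrable (fun x : ℝ => x) (gaussianReal 0 1) :=
    (memLp_id_gaussianReal (μ := 0) (v := 1) 1).integrable le_rfl
  rw [gaussianReal_of_var_ne_zero 0 one_ne_zero,
    integrable_withDensity_iff (measurable_gaussianPDF 0 1)
      (ae_of_all _ fun _ => gaussianPDF_lt_top)] at h
  simpa [toReal_gaussianPDF] using h

/-- The density φ satisfies φ' = -xφ, so -φ is an antiderivative of the integrand, and it vanishes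
at infinity. -/
theorem setIntegral_Ioi_id_mul_gaussianPDFReal_std (s : ℝ) :
    ∫ x in Set.Ioi s, x * gaussianPDFReal 0 1 x = gaussianPDFReal 0 1 s := by
  have h := integral_Ioi_of_hasDerivAt_of_tendsto' (a := s)
    (f := fun x => -gaussianPDFReal 0 1 x) (f' := fun x => x * gaussianPDFReal 0 1 x) (m := 0)
    (fun x _ => by simpa using (hasDerivAt_gaussianPDFReal_std x).fun_neg)
    integrable_id_mul_gaussianPDFReal_std.integrableOn
    (by simpa using tendsto_gaussianPDFReal_std_atTop.neg)
  simpa using h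

theorem setIntegral_Ioi_id_gaussianReal_std (s : ℝ) :
    ∫ x in Set.Ioi s, x ∂gaussianReal 0 1 = gaussianPDFReal 0 1 s := by
  rw [gaussianReal_of_var_ne_zero 0 one_ne_zero, restrict_withDensity measurableSet_Ioi,
    integral_withDensity_eq_integral_toReal_smul (measurable_gaussianPDF 0 1)
      (ae_of_all _ fun _ => gaussianPDF_lt_top)]
  simpa [toReal_gaussianPDF, mul_comm] using setIntegral_Ioi_id_mul_gaussianPDFReal_std s

/-- The covariance of the identity and the indicator of `(s, ∞)` under the standard Gaussian is
the density at `s`; here written as a double integral. -/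
theorem lintegral_lintegral_sub_gaussianReal_std (s : ℝ) :
    ∫⁻ x in Set.Ioi s, ∫⁻ y in Set.Iic s, ENNReal.ofReal (x - y) ∂gaussianReal 0 1
      ∂gaussianReal 0 1 = gaussianPDF 0 1 s := by
  set γ := gaussianReal 0 1
  have hid : Integrable (fun x : ℝ => x) γ :=
    (memLp_id_gaussianReal (μ := 0) (v := 1) 1).integrable le_rfl
  have hmean : ∫ x, x ∂γ = 0 := integral_id_gaussianReal
  have hle : ∫ y in Set.Iic s, y ∂γ = - gaussianPDFReal 0 1 s := by
    have := integral_add_compl (μ := γ) (measurableSet_Ioi (a := s)) hid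
    rw [setIntegral_Ioi_id_gaussianReal_std, hmean, Set.compl_Ioi] at this
    linarith
  have hone : γ.real (Set.Iic s) + γ.real (Set.Ioi s) = 1 := by
    have := measureReal_add_measureReal_compl (μ := γ) (measurableSet_Iic (a := s))
    simpa using this
  have hin : ∀ x ∈ Set.Ioi s, ∫⁻ y in Set.Iic s, ENNReal.ofReal (x - y) ∂γ =
      ENNReal.ofReal (x * γ.real (Set.Iic s) + gaussianPDFReal 0 1 s) := by
    intro x hx
    have hint : Integrable (fun y => x - y) (γ.restrict (Set.Iic s)) :=
      ((integrable_const x).sub hid).restrict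
    rw [← ofReal_integral_eq_lintegral_ofReal hint]
    · congr 1
      rw [integral_sub (integrable_const x) hid.restrict, hle]
      simp [mul_comm]
    · filter_upwards [ae_restrict_mem measurableSet_Iic] with y hy
      simp only [Set.mem_Iic, Set.mem_Ioi, Pi.zero_apply] at *
      linarith
  rw [setLIntegral_congr_fun measurableSet_Ioi hin]
  have hint : Integrable (fun x => x * γ.real (Set.Iic s) + gaussianPDFReal 0 1 s)
      (γ.restrict (Set.Ioi s)) := ((hid.mul_const _).add (integrable_const _)).restrict
  rw [← ofReal_integral_eq_lintegral_ofReal hint]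
  · rw [gaussianPDF]
    congr 1
    rw [integral_add (hid.mul_const _).restrict (integrable_const _), integral_mul_const,
      setIntegral_Ioi_id_gaussianReal_std]
    simp only [integral_const, MeasurableSet.univ, measureReal_restrict_apply, Set.univ_inter,
      smul_eq_mul]
    -- Both remaining terms are the density at `s` times the mass of a half-line, and the two masses
    -- add up to one.
    linear_combination gaussianPDFReal 0 1 s * hone
  · filter_upwards [ae_restrict_mem measurableSet_Ioi] with x hx
    have : 0 ≤ ∫ y in Set.Iic s, (x - y) ∂γ := by
      refine setIntegral_nonneg measurableSet_Iic fun y hy => ?_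
      simp only [Set.mem_Iic, Set.mem_Ioi] at *
      linarith
    rw [integral_sub (integrable_const x) hid.restrict, hle] at this
    simp [mul_comm] at this ⊢
    linarith

/-- The convention y < s ≤ x is that of `Set.uIoc`; as the Gaussian has no atoms, moving the
endpoint changes nothing. -/
theorem lintegral_lintegral_sub_gaussianReal_std' (s : ℝ) :
    ∫⁻ x in Set.Ici s, ∫⁻ y in Set.Iio s, ENNReal.ofReal (x - y) ∂gaussianReal 0 1
      ∂gaussianReal 0 1 = gaussianPDF 0 1 s := by
  have := nullSingletonClass_gaussianReal (μ := 0) (v := 1) one_ne_zero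
  rw [← lintegral_lintegral_sub_gaussianReal_std, Measure.restrict_congr_set Ioi_ae_eq_Ici,
    Measure.restrict_congr_set Iio_ae_eq_Iic]

/-- The fundamental theorem of calculus, then Cauchy-Schwarz against the constant 1. -/
theorem sq_enorm_sub_le_of_absolutelyContinuous {f : ℝ → ℝ} {a b : ℝ}
    (hf : AbsolutelyContinuousOnInterval f a b) :
    ‖f b - f a‖ₑ ^ 2 ≤ ENNReal.ofReal |b - a| * ∫⁻ s in Set.uIoc a b, ‖deriv f s‖ₑ ^ 2 := by
  have h1 : ‖f b - f a‖ₑ ≤ ∫⁻ s in Set.uIoc a b, ‖deriv f s‖ₑ := by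
    rw [← hf.integral_deriv_eq_sub]
    refine le_trans ?_ (enorm_integral_le_lintegral_enorm _)
    rw [← ofReal_norm, ← ofReal_norm, intervalIntegral.norm_integral_eq_norm_integral_uIoc]
  have h2 := ENNReal.lintegral_mul_le_Lp_mul_Lq (volume.restrict (Set.uIoc a b))
    Real.HolderConjugate.two_two (f := fun _ => (1 : ℝ≥0∞)) (g := fun s => ‖deriv f s‖ₑ)
    aemeasurable_const (measurable_deriv f).enorm.aemeasurable
  have h3 := h1.trans (le_of_eq_of_le (by simp) h2)
  have h4 := pow_le_pow_left' h3 2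
  have hhalf : ∀ u : ℝ≥0∞, (u ^ (1 / 2 : ℝ)) ^ 2 = u := fun u => by
    rw [← ENNReal.rpow_two, ← ENNReal.rpow_mul]
    norm_num
  rw [mul_pow, hhalf, hhalf] at h4
  simpa [Real.volume_uIoc] using h4

/-- After the Cauchy-Schwarz bound, Tonelli moves the integral over s outside; what multiplies
|f'(s)|² is the mean of |x - y| over pairs separated by s, which is twice the density. -/
theorem lintegral_lintegral_sq_enorm_sub_le_gaussianReal {f : ℝ → ℝ}
    (hf : ∀ a b, AbsolutelyContinuousOnInterval f a b) :
    ∫⁻ x, ∫⁻ y, ‖f x - f y‖ₑ ^ 2 ∂gaussianReal 0 1 ∂gaussianReal 0 1 ≤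
      2 * ∫⁻ s, ‖deriv f s‖ₑ ^ 2 ∂gaussianReal 0 1 := by
  set γ := gaussianReal 0 1 with hγ
  set g : ℝ → ℝ≥0∞ := fun s => ‖deriv f s‖ₑ ^ 2 with hg
  have hgm : Measurable g := (measurable_deriv f).enorm.pow_const 2
  -- The kernel is x - y where y < s ≤ x and zero elsewhere.
  set k : ℝ → ℝ → ℝ → ℝ≥0∞ := fun s x y =>
    (Set.Ici s).indicator (fun x => (Set.Iio s).indicator (fun y => ENNReal.ofReal (x - y)) y) x
    with hk
  have hkm : Measurable fun p : ℝ × ℝ × ℝ => k p.1 p.2.1 p.2.2 := by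
    have : (fun p : ℝ × ℝ × ℝ => k p.1 p.2.1 p.2.2) =
        {p : ℝ × ℝ × ℝ | p.1 ≤ p.2.1}.indicator
          ({p : ℝ × ℝ × ℝ | p.2.2 < p.1}.indicator
            fun p => ENNReal.ofReal (p.2.1 - p.2.2)) := rfl
    rw [this]
    refine Measurable.indicator (Measurable.indicator (by fun_prop) ?_) ?_
    · exact measurableSet_lt (by fun_prop) (by fun_prop)
    · exact measurableSet_le (by fun_prop) (by fun_prop)
  have hkint : ∀ s, ∫⁻ x, ∫⁻ y, k s x y ∂γ ∂γ = gaussianPDF 0 1 s := by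
    intro s
    rw [← lintegral_lintegral_sub_gaussianReal_std' s, ← lintegral_indicator measurableSet_Ici]
    refine lintegral_congr fun x => ?_
    by_cases hx : x ∈ Set.Ici s
    · simp only [hk, Set.indicator_of_mem hx]
      rw [lintegral_indicator measurableSet_Iio]
    · simp [hk, Set.indicator_of_notMem hx]
  have hpt : ∀ x y, y ≤ x →
      ENNReal.ofReal (x - y) * ∫⁻ s in Set.Ioc y x, g s ≤ ∫⁻ s, g s * k s x y := by
    intro x y hxy
    rw [← lintegral_const_mul _ hgm, ← lintegral_indicator measurableSet_Ioc]
    refine lintegral_mono fun s => ?_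
    by_cases hs : s ∈ Set.Ioc y x
    · have h1 : x ∈ Set.Ici s := hs.2
      have h2 : y ∈ Set.Iio s := hs.1
      simp [hk, Set.indicator_of_mem hs, Set.indicator_of_mem h1, Set.indicator_of_mem h2, mul_comm]
    · simp [Set.indicator_of_notMem hs]
  have hkm1 : ∀ x y, Measurable fun s => k s x y := fun x y =>
    hkm.comp (f := fun s => (s, x, y)) (by fun_prop)
  -- Adding the swapped kernel covers both orders of x and y; it is the source of the factor 2.
  have hbound : ∀ x y, ‖f x - f y‖ₑ ^ 2 ≤ ∫⁻ s, g s * (k s x y + k s y x) := by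
    intro x y
    refine (sq_enorm_sub_le_of_absolutelyContinuous (hf y x)).trans ?_
    have hm : Measurable fun s => g s * k s x y := hgm.mul (hkm1 x y)
    simp_rw [mul_add]
    rw [lintegral_add_left hm]
    rcases le_total y x with h | h
    · rw [Set.uIoc_of_le h, abs_of_nonneg (sub_nonneg.2 h)]
      exact (hpt x y h).trans le_self_add
    · rw [Set.uIoc_of_ge h, abs_of_nonpos (sub_nonpos.2 h), neg_sub]
      exact (hpt y x h).trans le_add_self
  have hm3 : Measurable fun p : (ℝ × ℝ) × ℝ => g p.2 * (k p.2 p.1.1 p.1.2 + k p.2 p.1.2 p.1.1) := by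
    refine (hgm.comp measurable_snd).mul (Measurable.add ?_ ?_)
    · exact hkm.comp (f := fun p : (ℝ × ℝ) × ℝ => (p.2, p.1.1, p.1.2)) (by fun_prop)
    · exact hkm.comp (f := fun p : (ℝ × ℝ) × ℝ => (p.2, p.1.2, p.1.1)) (by fun_prop)
  have hk2 : ∀ s, Measurable fun p : ℝ × ℝ => k s p.1 p.2 := fun s =>
    hkm.comp (f := fun p : ℝ × ℝ => (s, p.1, p.2)) (by fun_prop)
  calc ∫⁻ x, ∫⁻ y, ‖f x - f y‖ₑ ^ 2 ∂γ ∂γ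
      ≤ ∫⁻ x, ∫⁻ y, (∫⁻ s, g s * (k s x y + k s y x)) ∂γ ∂γ :=
        lintegral_mono fun x => lintegral_mono fun y => hbound x y
    _ = ∫⁻ p : ℝ × ℝ, (∫⁻ s : ℝ, g s * (k s p.1 p.2 + k s p.2 p.1)) ∂(γ.prod γ) := by
        rw [lintegral_prod _ (hm3.lintegral_prod_right' (ν := volume)).aemeasurable]
    _ = ∫⁻ s : ℝ, ∫⁻ p : ℝ × ℝ, g s * (k s p.1 p.2 + k s p.2 p.1) ∂(γ.prod γ) :=
        lintegral_lintegral_swap hm3.aemeasurable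
    _ = ∫⁻ s, 2 * (gaussianPDF 0 1 s * g s) := by
        refine lintegral_congr fun s => ?_
        have h1 : ∫⁻ p, k s p.1 p.2 ∂(γ.prod γ) = gaussianPDF 0 1 s := by
          rw [lintegral_prod _ (hk2 s).aemeasurable, hkint]
        have hk2' : Measurable fun p : ℝ × ℝ => k s p.2 p.1 := (hk2 s).comp measurable_swap
        have h2 : ∫⁻ p, k s p.2 p.1 ∂(γ.prod γ) = gaussianPDF 0 1 s := by
          rw [lintegral_prod_symm _ hk2'.aemeasurable, ← hkint s]
        rw [lintegral_const_mul _ (Measurable.fun_add (hk2 s) hk2'),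
          lintegral_add_left (hk2 s), h1, h2]
        ring
    _ = 2 * ∫⁻ s, g s ∂γ := by
        rw [lintegral_const_mul _ ((measurable_gaussianPDF 0 1).fun_mul hgm), hγ,
          gaussianReal_of_var_ne_zero 0 one_ne_zero,
          lintegral_withDensity_eq_lintegral_mul _ (measurable_gaussianPDF 0 1) hgm]
        rfl

/-- For square integrable functions, the variance is half the mean squared difference of two
independent copies. -/
theorem two_mul_lintegral_sq_enorm_sub_integral {Ω : Type*} [MeasurableSpace Ω] {P : Measure Ω}
    [IsProbabilityMeasure P] {f : Ω → ℝ} (hf : MemLp f 2 P) :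
    2 * ∫⁻ x, ‖f x - ∫ y, f y ∂P‖ₑ ^ 2 ∂P = ∫⁻ x, ∫⁻ y, ‖f x - f y‖ₑ ^ 2 ∂P ∂P := by
  have hi : Integrable f P := hf.integrable one_le_two
  set c := ∫ y, f y ∂P with hc
  have hen : ∀ u : ℝ, ‖u‖ₑ ^ 2 = ENNReal.ofReal (u ^ 2) := fun u => by
    rw [← ofReal_norm, ← ENNReal.ofReal_pow (norm_nonneg _), Real.norm_eq_abs, sq_abs]
  have hsq : Integrable (fun x => (f x - c) ^ 2) P := (hf.sub (memLp_const c)).integrable_sq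
  have h1 : ∀ x, ∫⁻ y, ‖f x - f y‖ₑ ^ 2 ∂P =
      ENNReal.ofReal ((f x - c) ^ 2 + ∫ y, (f y - c) ^ 2 ∂P) := by
    intro x
    simp_rw [hen]
    have hsx : Integrable (fun y => (f x - f y) ^ 2) P := ((memLp_const (f x)).sub hf).integrable_sq
    rw [← ofReal_integral_eq_lintegral_ofReal hsx (ae_of_all _ fun _ => sq_nonneg _)]
    congr 1
    have : ∀ y, (f x - f y) ^ 2 = (f x - c) ^ 2 - 2 * (f x - c) * (f y - c) + (f y - c) ^ 2 :=
      fun y => by ring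
    have hi' : Integrable (fun y => f y - c) P := hi.sub (integrable_const c)
    have hs : Integrable (fun y => (f x - c) ^ 2 - 2 * (f x - c) * (f y - c)) P :=
      (integrable_const _).sub (hi'.const_mul _)
    simp_rw [this]
    rw [integral_add hs hsq,
      integral_sub (integrable_const _) (hi'.const_mul _), integral_const_mul,
      integral_sub hi (integrable_const c)]
    simp [hc]
  simp_rw [h1, hen]
  have hnn : 0 ≤ ∫ y, (f y - c) ^ 2 ∂P := integral_nonneg fun _ => sq_nonneg _
  rw [← ofReal_integral_eq_lintegral_ofReal hsq (ae_of_all _ fun _ => sq_nonneg _),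
    ← ofReal_integral_eq_lintegral_ofReal (hsq.fun_add (integrable_const _))
      (ae_of_all _ fun _ => by positivity), integral_add hsq (integrable_const _)]
  simp only [integral_const, probReal_univ, one_smul]
  rw [← two_mul, ENNReal.ofReal_mul zero_le_two]
  simp

/-- The mean minimizes the mean squared deviation from a constant. -/
theorem lintegral_sq_enorm_sub_integral_le {Ω : Type*} [MeasurableSpace Ω] {P : Measure Ω}
    [IsProbabilityMeasure P] {f : Ω → ℝ} (hf : MemLp f 2 P) (c : ℝ) :
    ∫⁻ x, ‖f x - ∫ y, f y ∂P‖ₑ ^ 2 ∂P ≤ ∫⁻ x, ‖f x - c‖ₑ ^ 2 ∂P := by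
  have hi : Integrable f P := hf.integrable one_le_two
  set e := ∫ y, f y ∂P with he
  have hen : ∀ u : ℝ, ‖u‖ₑ ^ 2 = ENNReal.ofReal (u ^ 2) := fun u => by
    rw [← ofReal_norm, ← ENNReal.ofReal_pow (norm_nonneg _), Real.norm_eq_abs, sq_abs]
  simp_rw [hen]
  have hsq : Integrable (fun x => (f x - e) ^ 2) P := (hf.sub (memLp_const e)).integrable_sq
  have hsc : Integrable (fun x => (f x - c) ^ 2) P := (hf.sub (memLp_const c)).integrable_sq
  rw [← ofReal_integral_eq_lintegral_ofReal hsq (ae_of_all _ fun _ => sq_nonneg _),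
    ← ofReal_integral_eq_lintegral_ofReal hsc (ae_of_all _ fun _ => sq_nonneg _)]
  refine ENNReal.ofReal_le_ofReal ?_
  -- The cross term integrates to zero because `e` is the mean, leaving the nonnegative excess (e -
  -- c)².
  have : ∀ y, (f y - c) ^ 2 = (f y - e) ^ 2 + 2 * (e - c) * (f y - e) + (e - c) ^ 2 :=
    fun y => by ring
  have hi' : Integrable (fun y => f y - e) P := hi.sub (integrable_const e)
  simp_rw [this]
  rw [integral_add (hsq.fun_add (hi'.const_mul _)) (integrable_const _),
    integral_add hsq (hi'.const_mul _), integral_const_mul, integral_sub hi (integrable_const e)]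
  simp [he, sq_nonneg]

theorem gaussian_poincare {f : ℝ → ℝ} (hf : ∀ a b, AbsolutelyContinuousOnInterval f a b)
    (hL : MemLp f 2 (gaussianReal 0 1)) :
    ∫⁻ x, ‖f x - ∫ y, f y ∂gaussianReal 0 1‖ₑ ^ 2 ∂gaussianReal 0 1 ≤
      ∫⁻ s, ‖deriv f s‖ₑ ^ 2 ∂gaussianReal 0 1 := by
  have h := lintegral_lintegral_sq_enorm_sub_le_gaussianReal hf
  rw [← two_mul_lintegral_sq_enorm_sub_integral hL] at h
  exact (ENNReal.mul_le_mul_iff_right two_ne_zero ENNReal.ofNat_ne_top).1 h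

/-! ### Totality of the cosines in L² -/

section Density

variable {M : Type*} [NormedAddCommGroup M] [InnerProductSpace ℝ M] [CompleteSpace M]
  [SecondCountableTopology M] [MeasurableSpace M] [BorelSpace M]

/-- The positive and negative parts of F are densities of finite measures whose characteristic
functions agree: the phases 0 and -π/2 give the real and imaginary parts of their difference. -/
theorem ae_eq_zero_of_integral_mul_cos_eq_zero {ν : Measure M} [IsFiniteMeasure ν] {F : M → ℝ}
    (hF : Integrable F ν)
    (h : ∀ (k : M) (c : ℝ), ∫ x, F x * Real.cos (inner ℝ k x + c) ∂ν = 0) : F =ᵐ[ν] 0 := by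
  have hfin : ∀ G : M → ℝ, Integrable G ν →
      IsFiniteMeasure (ν.withDensity fun x => ENNReal.ofReal (G x)) := fun G hG =>
    isFiniteMeasure_withDensity_ofReal hG.2
  have hchar : ∀ (G : M → ℝ), Integrable G ν → ∀ t : M,
      charFun (ν.withDensity fun x => ENNReal.ofReal (G x)) t =
        ∫ x, (max (G x) 0) • Complex.exp (inner ℝ x t * Complex.I) ∂ν := by
    intro G hG t
    rw [charFun_apply, integral_withDensity_eq_integral_toReal_smul₀ hG.aemeasurable.ennreal_ofReal
      (ae_of_all _ fun _ => ENNReal.ofReal_lt_top)]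
    simp_rw [ENNReal.toReal_ofReal']
  have hexp : ∀ (G : M → ℝ), Integrable G ν → ∀ t : M,
      Integrable (fun x => G x • Complex.exp (inner ℝ x t * Complex.I)) ν := by
    intro G hG t
    refine hG.smul_bdd 1 (by fun_prop) (ae_of_all _ fun x => ?_)
    exact (Complex.norm_exp_ofReal_mul_I _).le
  have hkey : ∀ t : M, ∫ x, F x • Complex.exp (inner ℝ x t * Complex.I) ∂ν = 0 := by
    intro t
    have hre : ∀ x, (F x • Complex.exp (inner ℝ x t * Complex.I)).re =
        F x * Real.cos (inner ℝ t x + 0) := fun x => by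
      rw [Complex.smul_re, Complex.exp_ofReal_mul_I_re, add_zero, real_inner_comm, smul_eq_mul]
    have him : ∀ x, (F x • Complex.exp (inner ℝ x t * Complex.I)).im =
        F x * Real.cos (inner ℝ t x + -(Real.pi / 2)) := fun x => by
      rw [Complex.smul_im, Complex.exp_ofReal_mul_I_im, ← sub_eq_add_neg, Real.cos_sub_pi_div_two,
        real_inner_comm, smul_eq_mul]
    apply Complex.ext
    · have := integral_re (hexp F hF t)
      simp only [RCLike.re_eq_complex_re] at this
      rw [← this]
      simp_rw [hre]
      simpa using h t 0
    · have := integral_im (hexp F hF t)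
      simp only [RCLike.im_eq_complex_im] at this
      rw [← this]
      simp_rw [him]
      simpa using h t (-(Real.pi / 2))
  have := hfin F hF
  have := hfin (fun x => -F x) hF.neg
  have heq : ν.withDensity (fun x => ENNReal.ofReal (F x)) =
      ν.withDensity (fun x => ENNReal.ofReal (-F x)) := by
    refine Measure.ext_of_charFun (funext fun t => ?_)
    rw [hchar F hF, hchar (fun x => -F x) hF.neg, ← sub_eq_zero, ← integral_sub (hexp _ hF.pos_part t)
      (hexp _ hF.neg_part t), ← hkey t]
    refine integral_congr_ae (ae_of_all _ fun x => ?_)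
    simp only
    rw [← sub_smul]
    congr 1
    rcases le_total 0 (F x) with hx | hx <;> simp [hx]
  rw [withDensity_eq_iff (g := fun x => ENNReal.ofReal (-F x))
    hF.aemeasurable.ennreal_ofReal hF.neg.aemeasurable.ennreal_ofReal
    ((lintegral_ofReal_le_lintegral_enorm F).trans_lt hF.2).ne] at heq
  -- The positive and negative parts agree, but at each point at least one of them is zero.
  filter_upwards [heq] with x hx
  rcases le_total 0 (F x) with h0 | h0
  · rw [ENNReal.ofReal_of_nonpos (neg_nonpos.2 h0), ENNReal.ofReal_eq_zero] at hx
    exact le_antisymm hx h0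
  · rw [ENNReal.ofReal_of_nonpos h0, eq_comm, ENNReal.ofReal_eq_zero] at hx
    exact le_antisymm h0 (neg_nonpos.1 hx)

theorem memLp_cos {Ω : Type*} [MeasurableSpace Ω] {P : Measure Ω} [IsFiniteMeasure P] {X : Ω → ℝ}
    (hX : AEStronglyMeasurable X P) (c : ℝ) : MemLp (fun x => Real.cos (X x + c)) 2 P :=
  MemLp.of_bound (C := 1)
    (Real.continuous_cos.comp_aestronglyMeasurable (hX.add aestronglyMeasurable_const))
    (ae_of_all _ fun _ => Real.abs_cos_le_one _)

/-- A closed subspace of `L²(ν)` containing the functions `cos (⟨k, x⟩ + c)` is everything. -/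
theorem submodule_eq_top_of_cos_mem {ν : Measure M} [IsFiniteMeasure ν]
    {U : Submodule ℝ (Lp ℝ 2 ν)} (hU : IsClosed (U : Set (Lp ℝ 2 ν)))
    (h : ∀ (k : M) (c : ℝ), (memLp_cos (P := ν) (X := fun x => inner ℝ k x)
      (by fun_prop) c).toLp _ ∈ U) : U = ⊤ := by
  have : CompleteSpace U := hU.completeSpace_coe
  rw [← Submodule.orthogonal_eq_bot_iff, Submodule.eq_bot_iff]
  intro F hF
  rw [Lp.eq_zero_iff_ae_eq_zero]
  refine ae_eq_zero_of_integral_mul_cos_eq_zero ((Lp.memLp F).integrable one_le_two) fun k c => ?_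
  have := hF _ (h k c)
  rw [L2.inner_def] at this
  rw [← this]
  refine integral_congr_ae ?_
  filter_upwards [MemLp.coeFn_toLp (memLp_cos (P := ν) (X := fun x => inner ℝ k x)
      (by fun_prop) c)] with x hx
  rw [hx]
  simp

/-- A closed subspace of `L²(P)` containing all `cos (⟨k, Y⟩ + c)` contains the square integrable
functions of `Y`. -/
theorem toLp_comp_mem_of_cos_mem {Ω : Type*} [MeasurableSpace Ω] {P : Measure Ω}
    [IsFiniteMeasure P] {Y : Ω → M} (hY : Measurable Y)
    {W : Submodule ℝ (Lp ℝ 2 P)} (hW : IsClosed (W : Set (Lp ℝ 2 P)))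
    (h : ∀ (k : M) (c : ℝ), (memLp_cos (P := P) (X := fun x => inner ℝ k (Y x))
      (by fun_prop) c).toLp _ ∈ W) {φ : M → ℝ} (hφ : MemLp φ 2 (P.map Y)) :
    (hφ.comp_measurePreserving (hY.measurePreserving P)).toLp _ ∈ W := by
  set L := Lp.compMeasurePreservingₗᵢ (E := ℝ) ℝ (p := 2) Y (hY.measurePreserving P)
  -- Composition with `Y` is an isometry of L² spaces, so the preimage of `W` is a closed subspace
  -- containing the cosines.
  have htop : W.comap L.toLinearMap = ⊤ := by
    refine submodule_eq_top_of_cos_mem (hW.preimage L.continuous) fun k c => ?_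
    have := h k c
    rw [Submodule.mem_comap]
    exact this
  have hmem : hφ.toLp φ ∈ W.comap L.toLinearMap := htop ▸ Submodule.mem_top
  exact hmem

end Density

/-! ### The Cameron-Martin space, cosines and directional averages -/

section Basic

variable {M : Type*} [NormedAddCommGroup M] [InnerProductSpace ℝ M] [CompleteSpace M]
  [SecondCountableTopology M] [MeasurableSpace M] [BorelSpace M]

/-- The inclusion of the Cameron--Martin space into `L²(μ)`. -/
def cmLp (μ : Measure M) : CMSpace μ →ₗᵢ[ℝ] Lp ℝ 2 μ := (cmSubmodule μ).subtypeₗᵢ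

/-- The element of the Cameron--Martin space given by the functional `⟨k, ·⟩`. -/
def cmOf (μ : Measure M) (k : M) : CMSpace μ :=
  (⟨StrongDual.toLp (𝕜 := ℝ) (E := M) μ 2 (innerSL ℝ k),
    Submodule.le_topologicalClosure _ ⟨innerSL ℝ k, rfl⟩⟩ : cmSubmodule μ)

theorem cmExt_eq (μ : Measure M) (h : CMSpace μ) : cmExt μ h = cmLp μ h := rfl

theorem denseRange_cmOf (μ : Measure M) : DenseRange (cmOf μ) := by
  intro h
  rw [Metric.mem_closure_iff]
  intro ε hε
  have h1 : ((show cmSubmodule μ from h) : Lp ℝ 2 μ) ∈ closure (LinearMap.range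
      (StrongDual.toLp (𝕜 := ℝ) (E := M) μ 2).toLinearMap : Set (Lp ℝ 2 μ)) :=
    (show cmSubmodule μ from h).2
  obtain ⟨_, ⟨L, rfl⟩, hL⟩ := Metric.mem_closure_iff.1 h1 ε hε
  refine ⟨_, ⟨(InnerProductSpace.toDual ℝ M).symm L, rfl⟩, ?_⟩
  have : innerSL ℝ ((InnerProductSpace.toDual ℝ M).symm L) = L := by
    ext x; simp
  change dist ((show cmSubmodule μ from h) : Lp ℝ 2 μ) (StrongDual.toLp (𝕜 := ℝ) (E := M) μ 2
    (innerSL ℝ ((InnerProductSpace.toDual ℝ M).symm L))) < ε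
  rw [this]
  exact hL

variable {μ : Measure M}

@[fun_prop]
theorem measurable_cmExt (h : CMSpace μ) : Measurable (cmExt μ h) :=
  (Lp.stronglyMeasurable _).measurable

theorem memLp_cmExt (h : CMSpace μ) : MemLp (cmExt μ h) 2 μ := Lp.memLp _

theorem cmExt_add (g h : CMSpace μ) : cmExt μ (g + h) =ᵐ[μ] cmExt μ g + cmExt μ h := by
  simp_rw [cmExt_eq, map_add]
  exact Lp.coeFn_add _ _

theorem cmExt_sub (g h : CMSpace μ) : cmExt μ (g - h) =ᵐ[μ] cmExt μ g - cmExt μ h := by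
  simp_rw [cmExt_eq, map_sub]
  exact Lp.coeFn_sub _ _

theorem cmExt_smul (c : ℝ) (h : CMSpace μ) : cmExt μ (c • h) =ᵐ[μ] c • cmExt μ h := by
  simp_rw [cmExt_eq, map_smul]
  exact Lp.coeFn_smul _ _

theorem cmExt_sum {ι : Type*} (s : Finset ι) (c : ι → ℝ) (g : ι → CMSpace μ) :
    cmExt μ (∑ i ∈ s, c i • g i) =ᵐ[μ] fun m => ∑ i ∈ s, c i * cmExt μ (g i) m := by
  classical
  induction s using Finset.induction_on with
  | empty =>
    simp only [Finset.sum_empty, cmExt_eq, map_zero]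
    exact Lp.coeFn_zero _ _ _
  | insert i s hi ih =>
    rw [Finset.sum_insert hi]
    filter_upwards [cmExt_add (c i • g i) (∑ i ∈ s, c i • g i), cmExt_smul (c i) (g i), ih]
      with m h1 h2 h3
    rw [h1, Pi.add_apply, h2, h3, Finset.sum_insert hi]
    rfl

theorem inner_cmSpace_eq (g h : CMSpace μ) :
    inner ℝ g h = ∫ m, cmExt μ g m * cmExt μ h m ∂μ := by
  rw [← (cmLp μ).inner_map_map, L2.inner_def]
  refine integral_congr_ae (ae_of_all _ fun m => ?_)
  simp [cmExt_eq, mul_comm]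

variable [IsGaussian μ]

theorem cmExt_cmOf (k : M) : cmExt μ (cmOf μ k) =ᵐ[μ] fun m => inner ℝ k m := by
  have : cmExt μ (cmOf μ k) = StrongDual.toLp (𝕜 := ℝ) (E := M) μ 2 (innerSL ℝ k) := rfl
  rw [this, StrongDual.toLp_apply IsGaussian.memLp_two_id]
  exact MemLp.coeFn_toLp _

/-- The embedding into `M` is adjoint to `cmOf`; identities for `cmEmb` can thus be tested in the L²
model. -/
theorem inner_cmEmb (h : CMSpace μ) (k : M) :
    inner ℝ k (cmEmb μ h) = inner ℝ (cmOf μ k) h := by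
  have hint : Integrable (fun m => cmExt μ h m • m) μ :=
    memLp_one_iff_integrable.1 (IsGaussian.memLp_two_id.smul (memLp_cmExt h))
  rw [cmEmb, ← integral_inner hint, inner_cmSpace_eq]
  refine integral_congr_ae ?_
  filter_upwards [cmExt_cmOf (μ := μ) k] with m hm
  rw [hm, inner_smul_right, mul_comm]

theorem cmEmb_sum {ι : Type*} (s : Finset ι) (c : ι → ℝ) (g : ι → CMSpace μ) :
    cmEmb μ (∑ i ∈ s, c i • g i) = ∑ i ∈ s, c i • cmEmb μ (g i) := by
  refine ext_inner_left ℝ fun k => ?_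
  simp_rw [inner_cmEmb, inner_sum, inner_smul_right, inner_cmEmb]

/-- The function `cos (h + c)` for `h` in the Cameron--Martin space, as an element of `L²(μ)`. -/
def cosLp (μ : Measure M) [IsFiniteMeasure μ] (h : CMSpace μ) (c : ℝ) : Lp ℝ 2 μ :=
  (memLp_cos (measurable_cmExt h).aestronglyMeasurable c).toLp _

theorem coeFn_cosLp (h : CMSpace μ) (c : ℝ) :
    cosLp μ h c =ᵐ[μ] fun m => Real.cos (cmExt μ h m + c) := MemLp.coeFn_toLp _

/-- The cosine is 1-Lipschitz and the Cameron-Martin norm is the L² norm. -/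
theorem continuous_cosLp (c : ℝ) : Continuous fun h : CMSpace μ => cosLp μ h c := by
  refine LipschitzWith.continuous (K := 1) (LipschitzWith.of_dist_le_mul fun g h => ?_)
  rw [dist_eq_norm, dist_eq_norm, NNReal.coe_one, one_mul, ← (cmLp μ).norm_map (g - h)]
  refine Lp.norm_le_norm_of_ae_le ?_
  filter_upwards [Lp.coeFn_sub (cosLp μ g c) (cosLp μ h c), coeFn_cosLp g c, coeFn_cosLp h c,
    cmExt_sub g h] with m h1 h2 h3 h4
  rw [h1, ← cmExt_eq, h4, Pi.sub_apply, Pi.sub_apply, h2, h3]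
  have := Real.abs_cos_sub_cos_le (cmExt μ g m + c) (cmExt μ h m + c)
  simpa using this

/-- For continuous functionals this is the real part of the Gaussian characteristic function. Both
sides are continuous in h, and such functionals are dense. -/
theorem integral_cos_cmExt (hμ : ∫ m, m ∂μ = 0) (h : CMSpace μ) (c : ℝ) :
    ∫ m, Real.cos (cmExt μ h m + c) ∂μ = Real.exp (-‖h‖ ^ 2 / 2) * Real.cos c := by
  have hcont : Continuous fun h : CMSpace μ => ∫ m, Real.cos (cmExt μ h m + c) ∂μ := by
    have h1 : (fun h : CMSpace μ => ∫ m, Real.cos (cmExt μ h m + c) ∂μ) =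
        fun h => inner ℝ ((memLp_const (1 : ℝ)).toLp _ : Lp ℝ 2 μ) (cosLp μ h c) := by
      funext h
      rw [L2.inner_def]
      refine integral_congr_ae ?_
      filter_upwards [coeFn_cosLp h c] with m h1
      simp [h1]
    rw [h1]
    exact continuous_const.inner (continuous_cosLp c)
  refine congrFun ((denseRange_cmOf μ).equalizer hcont
    (by fun_prop : Continuous fun h : CMSpace μ => Real.exp (-‖h‖ ^ 2 / 2) * Real.cos c)
    (funext fun k => ?_)) h
  simp only [Function.comp_apply]
  have hc := IsGaussian.charFunDual_eq_of_integral_eq_zero (μ := μ) hμ (innerSL ℝ k)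
  have hvar : Var[innerSL ℝ k; μ] = ‖cmOf μ k‖ ^ 2 := by
    rw [variance_of_integral_eq_zero (by fun_prop)
      (by rw [IsGaussian.integral_dual, hμ, map_zero]), ← real_inner_self_eq_norm_sq,
      inner_cmSpace_eq]
    refine integral_congr_ae ?_
    filter_upwards [cmExt_cmOf (μ := μ) k] with m hm
    rw [hm, innerSL_apply_apply, sq]
  rw [hvar, charFunDual_apply] at hc
  have hint : Integrable (fun m => Complex.exp (Complex.I * c) *
      Complex.exp ((innerSL ℝ k m : ℝ) * Complex.I)) μ := by
    refine Integrable.const_mul ?_ _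
    refine (integrable_const (1 : ℝ)).mono' (by fun_prop) (ae_of_all _ fun m => ?_)
    exact (Complex.norm_exp_ofReal_mul_I _).le
  -- The factor exp(ic) builds the phase into the characteristic function.
  have h2 : ∫ m, Complex.exp (Complex.I * c) * Complex.exp ((innerSL ℝ k m : ℝ) * Complex.I) ∂μ =
      Complex.exp (Complex.I * c) * Complex.exp (-(‖cmOf μ k‖ ^ 2 : ℝ) / 2) := by
    rw [integral_const_mul, hc]
  have h3 := integral_re hint
  simp only [RCLike.re_eq_complex_re] at h3
  rw [h2] at h3
  have h4 : (Complex.exp (Complex.I * c) * Complex.exp (-(‖cmOf μ k‖ ^ 2 : ℝ) / 2)).re =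
      Real.exp (-‖cmOf μ k‖ ^ 2 / 2) * Real.cos c := by
    have : (-(‖cmOf μ k‖ ^ 2 : ℝ) / 2 : ℂ) = ((-‖cmOf μ k‖ ^ 2 / 2 : ℝ) : ℂ) := by push_cast; rfl
    rw [this, ← Complex.ofReal_exp, Complex.re_mul_ofReal, mul_comm Complex.I,
      Complex.exp_ofReal_mul_I_re, mul_comm]
  rw [← h4, ← h3]
  refine integral_congr_ae ?_
  filter_upwards [cmExt_cmOf (μ := μ) k] with m hm
  rw [hm, ← Complex.exp_add, innerSL_apply_apply]
  have : Complex.I * c + (inner ℝ k m : ℝ) * Complex.I = ((inner ℝ k m + c : ℝ) : ℂ) * Complex.I := by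
    push_cast; ring
  rw [this, Complex.exp_ofReal_mul_I_re]

/-- The `L²(μ)` inner product of two cosines. -/
theorem inner_cosLp (hμ : ∫ m, m ∂μ = 0) (g h : CMSpace μ) (c d : ℝ) :
    inner ℝ (cosLp μ g c) (cosLp μ h d) =
      (Real.exp (-‖g + h‖ ^ 2 / 2) * Real.cos (c + d) +
        Real.exp (-‖g - h‖ ^ 2 / 2) * Real.cos (c - d)) / 2 := by
  rw [← integral_cos_cmExt hμ, ← integral_cos_cmExt hμ, L2.inner_def, ← integral_add,
    ← integral_div]
  · refine integral_congr_ae ?_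
    filter_upwards [coeFn_cosLp g c, coeFn_cosLp h d, cmExt_add g h, cmExt_sub g h]
      with m h1 h2 h3 h4
    rw [h1, h2, h3, h4]
    simp only [RCLike.inner_apply, conj_trivial, Pi.add_apply, Pi.sub_apply]
    rw [show cmExt μ g m + cmExt μ h m + (c + d) = (cmExt μ g m + c) + (cmExt μ h m + d) by ring,
      show cmExt μ g m - cmExt μ h m + (c - d) = (cmExt μ g m + c) - (cmExt μ h m + d) by ring,
      Real.cos_add (cmExt μ g m + c), Real.cos_sub (cmExt μ g m + c)]
    ring
  · exact (memLp_cos (measurable_cmExt _).aestronglyMeasurable _).integrable one_le_two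
  · exact (memLp_cos (measurable_cmExt _).aestronglyMeasurable _).integrable one_le_two

/-- The closure in `L²(μ)` of the cosines in directions orthogonal to `e`. -/
def cosOrth (μ : Measure M) [IsGaussian μ] (e : CMSpace μ) : Submodule ℝ (Lp ℝ 2 μ) :=
  (Submodule.span ℝ {F | ∃ (g : CMSpace μ) (c : ℝ), inner ℝ e g = 0 ∧
    F = cosLp μ g c}).topologicalClosure

instance (e : CMSpace μ) : CompleteSpace (cosOrth μ e) :=
  inferInstanceAs (CompleteSpace (Submodule.topologicalClosure _))

theorem cosLp_mem_cosOrth {e g : CMSpace μ} (h : inner ℝ e g = 0) (c : ℝ) :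
    cosLp μ g c ∈ cosOrth μ e :=
  Submodule.le_topologicalClosure _ (Submodule.subset_span ⟨g, c, h, rfl⟩)

/-- Averaging the component a = ⟨e, h⟩ along e out of cos(h + c) leaves the cosine of the orthogonal
part, damped by exp(-a²/2). The residual is checked to be orthogonal to each generating cosine. -/
theorem starProjection_cosOrth_cosLp (hμ : ∫ m, m ∂μ = 0) {e : CMSpace μ} (he : ‖e‖ = 1)
    (h : CMSpace μ) (c : ℝ) :
    (cosOrth μ e).starProjection (cosLp μ h c) =
      Real.exp (-(inner ℝ e h) ^ 2 / 2) • cosLp μ (h - inner ℝ e h • e) c := by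
  set a := inner ℝ e h with ha
  have hee : inner ℝ e e = (1 : ℝ) := by rw [real_inner_self_eq_norm_sq, he, one_pow]
  have horth : inner ℝ e (h - a • e) = 0 := by
    rw [inner_sub_right, inner_smul_right, hee, ← ha]; ring
  refine Submodule.eq_starProjection_of_mem_orthogonal
    (Submodule.smul_mem _ _ (cosLp_mem_cosOrth horth c)) ?_
  rw [cosOrth, Submodule.orthogonal_closure, Submodule.mem_orthogonal]
  intro F hF
  induction hF using Submodule.span_induction with
  | mem F hF =>
    obtain ⟨g, d, hg, rfl⟩ := hF
    -- By Pythagoras, both exponentials in `inner_cosLp` acquire the same factor exp(-a²/2).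
    have hsplit : ∀ u : CMSpace μ, inner ℝ e u = 0 → ‖u + a • e‖ ^ 2 = ‖u‖ ^ 2 + a ^ 2 := by
      intro u hu
      rw [norm_add_sq_real, inner_smul_right, real_inner_comm, hu, norm_smul, he]
      simp
    have h1 : ‖g + h‖ ^ 2 = ‖g + (h - a • e)‖ ^ 2 + a ^ 2 := by
      rw [← hsplit _ (by rw [inner_add_right, hg, horth, add_zero])]
      congr 2; abel
    have h2 : ‖g - h‖ ^ 2 = ‖g - (h - a • e)‖ ^ 2 + a ^ 2 := by
      rw [norm_sub_rev g h, norm_sub_rev g,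
        ← hsplit _ (by rw [inner_sub_right, hg, horth, sub_zero])]
      congr 2; abel
    have hexp : ∀ x : ℝ, Real.exp (-(x + a ^ 2) / 2) =
        Real.exp (-a ^ 2 / 2) * Real.exp (-x / 2) := fun x => by
      rw [← Real.exp_add]; congr 1; ring
    rw [inner_sub_right, inner_smul_right, inner_cosLp hμ, inner_cosLp hμ, h1, h2, hexp, hexp]
    ring
  | zero => simp
  | add x y _ _ hx hy => rw [inner_add_left, hx, hy, add_zero]
  | smul r x _ hx => rw [inner_smul_left, hx, mul_zero]

/-- Averaging over finitely many orthonormal directions. -/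
theorem exists_finset_average (hμ : ∫ m, m ∂μ = 0) {ι : Type*} {e : ι → CMSpace μ}
    (he : Orthonormal ℝ e) (s : Finset ι) :
    ∃ P : Lp ℝ 2 μ →L[ℝ] Lp ℝ 2 μ, (∀ F, ‖P F‖ ≤ ‖F‖) ∧
      (∀ F, ‖F - P F‖ ^ 2 ≤ ∑ i ∈ s, ‖F - (cosOrth μ (e i)).starProjection F‖ ^ 2) ∧
      ∀ h c, P (cosLp μ h c) = Real.exp (-(∑ i ∈ s, (inner ℝ (e i) h) ^ 2) / 2) •
        cosLp μ (h - ∑ i ∈ s, inner ℝ (e i) h • e i) c := by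
  classical
  induction s using Finset.induction_on with
  | empty => exact ⟨ContinuousLinearMap.id ℝ _, by simp, by simp, by simp⟩
  | insert i s hi ih =>
    obtain ⟨P, hP1, hP2, hP3⟩ := ih
    refine ⟨(cosOrth μ (e i)).starProjection ∘L P, fun F => ?_, fun F => ?_, fun h c => ?_⟩
    · exact ((cosOrth μ (e i)).norm_starProjection_apply_le _).trans (hP1 F)
    · rw [Finset.sum_insert hi]
      set A := (cosOrth μ (e i)).starProjection with hA
      -- The first summand is orthogonal to the range of `A`, which contains the second; so squared
      -- errors add up, and `A` does not increase the second.
      have h1 : F - (A ∘L P) F = (F - A F) + A (F - P F) := by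
        rw [map_sub, ContinuousLinearMap.comp_apply]; abel
      have h2 : inner ℝ (F - A F) (A (F - P F)) = 0 :=
        (Submodule.mem_orthogonal' _ _).1 (Submodule.sub_starProjection_mem_orthogonal F) _
          (Submodule.starProjection_apply_mem _ _)
      have h3 : ‖A (F - P F)‖ ≤ ‖F - P F‖ := (cosOrth μ (e i)).norm_starProjection_apply_le _
      rw [h1, norm_add_sq_real, h2]
      have := hP2 F
      have h4 : ‖A (F - P F)‖ ^ 2 ≤ ‖F - P F‖ ^ 2 := by gcongr
      linarith
    · rw [ContinuousLinearMap.comp_apply, hP3, map_smul,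
        starProjection_cosOrth_cosLp hμ (he.1 i), smul_smul, ← Real.exp_add,
        Finset.sum_insert hi, Finset.sum_insert hi]
      -- The directions already removed do not change the component along `e i`.
      have h0 : inner ℝ (e i) (∑ j ∈ s, inner ℝ (e j) h • e j) = 0 := by
        rw [inner_sum]
        refine Finset.sum_eq_zero fun j hj => ?_
        rw [inner_smul_right, he.2 (ne_of_mem_of_not_mem hj hi).symm, mul_zero]
      rw [inner_sub_right, h0, sub_zero]
      congr 2
      · ring
      · abel

end Basic

/-! ### Laws of the encoder and the residual -/

section Law

variable {M : Type*} [NormedAddCommGroup M] [InnerProductSpace ℝ M] [CompleteSpace M]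
  [SecondCountableTopology M] [MeasurableSpace M] [BorelSpace M]

/-- The residual `m - Ψ Ψ^* m`. -/
def resid (μ : Measure M) {r : ℕ} (ψ : Fin r → CMSpace μ) (m : M) : M :=
  m - decoder μ ψ (encoder μ ψ m)

variable {μ : Measure M} [IsGaussian μ]

theorem integral_cexp_cmExt (hμ : ∫ m, m ∂μ = 0) (h : CMSpace μ) :
    ∫ m, Complex.exp ((cmExt μ h m : ℝ) * Complex.I) ∂μ = Complex.exp (-(‖h‖ : ℂ) ^ 2 / 2) := by
  have hint : Integrable (fun m => Complex.exp ((cmExt μ h m : ℝ) * Complex.I)) μ := by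
    refine (integrable_const (1 : ℝ)).mono' (by fun_prop) (ae_of_all _ fun m => ?_)
    exact (Complex.norm_exp_ofReal_mul_I _).le
  have hexp : Complex.exp (-(‖h‖ : ℂ) ^ 2 / 2) = (Real.exp (-‖h‖ ^ 2 / 2) : ℝ) := by
    push_cast; rfl
  rw [hexp]
  apply Complex.ext
  · have := integral_re hint
    simp only [RCLike.re_eq_complex_re] at this
    rw [← this]
    simp_rw [Complex.exp_ofReal_mul_I_re]
    rw [Complex.ofReal_re]
    simpa using integral_cos_cmExt hμ h 0
  · have := integral_im hint
    simp only [RCLike.im_eq_complex_im] at this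
    rw [← this]
    simp_rw [Complex.exp_ofReal_mul_I_im]
    rw [Complex.ofReal_im]
    simpa [← sub_eq_add_neg, Real.cos_sub_pi_div_two] using integral_cos_cmExt hμ h (-(Real.pi / 2))

variable {r : ℕ} {ψ : Fin r → CMSpace μ}

@[fun_prop]
theorem measurable_encoder : Measurable (encoder μ ψ) :=
  (WithLp.measurable_toLp 2 (Fin r → ℝ)).comp (measurable_pi_lambda _ fun j => measurable_cmExt (ψ j))

theorem decoder_eq (z : EuclideanSpace ℝ (Fin r)) :
    decoder μ ψ z = ∑ j, z j • cmEmb μ (ψ j) := cmEmb_sum _ _ _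

@[fun_prop]
theorem continuous_decoder : Continuous (decoder μ ψ) := by
  have : decoder μ ψ = fun z => ∑ j, z j • cmEmb μ (ψ j) := funext decoder_eq
  rw [this]
  fun_prop

@[fun_prop]
theorem measurable_resid : Measurable (resid μ ψ) :=
  measurable_id.sub (continuous_decoder.measurable.comp measurable_encoder)

theorem inner_encoder (z : EuclideanSpace ℝ (Fin r)) (m : M) :
    inner ℝ (encoder μ ψ m) z = ∑ j, z j * cmExt μ (ψ j) m := by
  simp [PiLp.inner_apply, encoder]

/-- Tested against k, the residual is the Gaussian variable of the part of `cmOf μ k` orthogonal to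
the reduced basis; independence from the encoder comes from this. -/
theorem inner_resid_ae (k : M) :
    (fun m => inner ℝ (resid μ ψ m) k) =ᵐ[μ]
      cmExt μ (cmOf μ k - ∑ j, inner ℝ (ψ j) (cmOf μ k) • ψ j) := by
  filter_upwards [cmExt_sub (cmOf μ k) (∑ j, inner ℝ (ψ j) (cmOf μ k) • ψ j),
    cmExt_cmOf (μ := μ) k, cmExt_sum Finset.univ (fun j => inner ℝ (ψ j) (cmOf μ k)) ψ]
    with m h1 h2 h3
  rw [h1, Pi.sub_apply, h2, h3, resid, inner_sub_left, real_inner_comm, decoder_eq, sum_inner]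
  congr 1
  refine Finset.sum_congr rfl fun j _ => ?_
  rw [inner_smul_left, real_inner_comm, inner_cmEmb, real_inner_comm]
  simp [encoder, mul_comm]

theorem norm_sum_smul_sq (hψ : Orthonormal ℝ ψ) (z : EuclideanSpace ℝ (Fin r)) :
    ‖∑ j, z j • ψ j‖ ^ 2 = ‖z‖ ^ 2 := by
  rw [← real_inner_self_eq_norm_sq, hψ.inner_sum, EuclideanSpace.real_norm_sq_eq]
  simp [sq]

theorem charFun_map_encoder (hμ : ∫ m, m ∂μ = 0) (hψ : Orthonormal ℝ ψ)
    (z : EuclideanSpace ℝ (Fin r)) :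
    charFun (μ.map (encoder μ ψ)) z = Complex.exp (-(‖z‖ : ℂ) ^ 2 / 2) := by
  have h := integral_cexp_cmExt hμ (∑ j, z j • ψ j)
  rw [charFun_apply, integral_map (by fun_prop) (by fun_prop)]
  have h2 := norm_sum_smul_sq hψ z
  have h3 : ‖∑ j, z j • ψ j‖ = ‖z‖ := by
    rwa [sq_eq_sq₀ (norm_nonneg _) (norm_nonneg _)] at h2
  rw [← h3, ← h]
  refine integral_congr_ae ?_
  filter_upwards [cmExt_sum Finset.univ (fun j => z j) ψ] with m hm
  rw [hm, inner_encoder]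

/-- The encoder has the standard Gaussian law. -/
theorem map_encoder (hμ : ∫ m, m ∂μ = 0) (hψ : Orthonormal ℝ ψ) :
    μ.map (encoder μ ψ) = stdGaussian (EuclideanSpace ℝ (Fin r)) := by
  have : IsProbabilityMeasure (μ.map (encoder μ ψ)) :=
    Measure.isProbabilityMeasure_map (by fun_prop)
  refine Measure.ext_of_charFun (funext fun z => ?_)
  rw [charFun_map_encoder hμ hψ, charFun_stdGaussian]

/-- The encoder and the residual are independent. -/
theorem indepFun_encoder_resid (hμ : ∫ m, m ∂μ = 0) (hψ : Orthonormal ℝ ψ) :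
    IndepFun (encoder μ ψ) (resid μ ψ) μ := by
  rw [indepFun_iff_charFun_prod (by fun_prop) (by fun_prop)]
  intro t
  set z := t.ofLp.1
  set k := t.ofLp.2
  set g := cmOf μ k - ∑ j, inner ℝ (ψ j) (cmOf μ k) • ψ j with hg
  have horth : ∀ j, inner ℝ (ψ j) g = 0 := fun j => by
    rw [hg, inner_sub_right, hψ.inner_right_fintype, sub_self]
  -- Orthogonality makes the joint characteristic function factor.
  have hsq : ‖∑ j, z j • ψ j + g‖ ^ 2 = ‖z‖ ^ 2 + ‖g‖ ^ 2 := by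
    rw [norm_add_sq_real, norm_sum_smul_sq hψ, sum_inner]
    simp [inner_smul_left, horth]
  have hk : charFun (μ.map (resid μ ψ)) k = Complex.exp (-(‖g‖ : ℂ) ^ 2 / 2) := by
    rw [charFun_apply, integral_map (by fun_prop) (by fun_prop), ← integral_cexp_cmExt hμ g]
    refine integral_congr_ae ?_
    filter_upwards [inner_resid_ae (ψ := ψ) k] with m hm
    rw [hm]
  rw [charFun_map_encoder hμ hψ, hk, ← Complex.exp_add]
  have h := integral_cexp_cmExt hμ (∑ j, z j • ψ j + g)
  rw [← Complex.ofReal_pow, hsq] at h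
  have h2 : -(‖z‖ : ℂ) ^ 2 / 2 + -(‖g‖ : ℂ) ^ 2 / 2 = -((‖z‖ ^ 2 + ‖g‖ ^ 2 : ℝ) : ℂ) / 2 := by
    push_cast; ring
  rw [h2, ← h, charFun_apply, integral_map (by fun_prop) (by fun_prop)]
  refine integral_congr_ae ?_
  filter_upwards [inner_resid_ae (ψ := ψ) k, cmExt_add (∑ j, z j • ψ j) g,
    cmExt_sum Finset.univ (fun j => z j) ψ] with m h3 h4 h5
  rw [WithLp.prod_inner_apply, h4, Pi.add_apply, h5, ← inner_encoder, ← h3]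

theorem map_prodMk_encoder_resid (hμ : ∫ m, m ∂μ = 0) (hψ : Orthonormal ℝ ψ) :
    μ.map (fun m => (encoder μ ψ m, resid μ ψ m)) =
      (stdGaussian (EuclideanSpace ℝ (Fin r))).prod (μ.map (resid μ ψ)) := by
  rw [(indepFun_iff_map_prod_eq_prod_map_map (by fun_prop) (by fun_prop)).1
    (indepFun_encoder_resid hμ hψ), map_encoder hμ hψ]

theorem decoder_encoder_add_resid (m : M) :
    decoder μ ψ (encoder μ ψ m) + resid μ ψ m = m := by
  rw [resid]; abel

theorem measurePreserving_decoder_add (hμ : ∫ m, m ∂μ = 0) (hψ : Orthonormal ℝ ψ) :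
    MeasurePreserving (fun p : EuclideanSpace ℝ (Fin r) × M => decoder μ ψ p.1 + p.2)
      ((stdGaussian (EuclideanSpace ℝ (Fin r))).prod (μ.map (resid μ ψ))) μ := by
  have hm : Measurable fun p : EuclideanSpace ℝ (Fin r) × M => decoder μ ψ p.1 + p.2 := by fun_prop
  refine ⟨hm, ?_⟩
  rw [← map_prodMk_encoder_resid hμ hψ, Measure.map_map hm (by fun_prop)]
  convert Measure.map_id
  ext m
  exact decoder_encoder_add_resid m

/-- A prior sample is the decoded encoder plus an independent residual, so a fresh Gaussian code and
the residual of a fresh sample recombine to the prior. This makes the reduced mapping well defined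
almost everywhere. -/
theorem measurePreserving_mixArg (hμ : ∫ m, m ∂μ = 0) (hψ : Orthonormal ℝ ψ) :
    MeasurePreserving (fun p : EuclideanSpace ℝ (Fin r) × M => mixArg μ ψ p.1 p.2)
      ((stdGaussian (EuclideanSpace ℝ (Fin r))).prod μ) μ := by
  refine (measurePreserving_decoder_add hμ hψ).comp
    (g := fun p : EuclideanSpace ℝ (Fin r) × M => decoder μ ψ p.1 + p.2)
    (f := Prod.map id (resid μ ψ)) ?_
  exact (MeasurePreserving.id _).prod (measurable_resid.measurePreserving μ)

/-- The residual in one direction. -/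
def lineResid (μ : Measure M) (e : CMSpace μ) (m : M) : M := m - cmExt μ e m • cmEmb μ e

@[fun_prop]
theorem measurable_lineResid (e : CMSpace μ) : Measurable (lineResid μ e) :=
  measurable_id.sub ((measurable_cmExt e).smul_const _)

theorem lineResid_eq (e : CMSpace μ) : lineResid μ e = resid μ (fun _ : Fin 1 => e) := by
  ext m
  simp [lineResid, resid, decoder_eq, encoder]

theorem map_cmExt (hμ : ∫ m, m ∂μ = 0) {e : CMSpace μ} (he : ‖e‖ = 1) :
    μ.map (cmExt μ e) = gaussianReal 0 1 := by
  have : IsProbabilityMeasure (μ.map (cmExt μ e)) :=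
    Measure.isProbabilityMeasure_map (by fun_prop)
  refine Measure.ext_of_charFun (funext fun t => ?_)
  have h := integral_cexp_cmExt hμ (t • e)
  rw [charFun_gaussianReal, charFun_apply, integral_map (by fun_prop) (by fun_prop)]
  rw [norm_smul, he, mul_one] at h
  have h2 : Complex.exp (t * ((0 : ℝ) : ℂ) * Complex.I - ((1 : NNReal) : ℝ) * t ^ 2 / 2) =
      Complex.exp (-(‖t‖ : ℂ) ^ 2 / 2) := by
    rw [← Complex.ofReal_pow ‖t‖, Real.norm_eq_abs, sq_abs]
    push_cast
    congr 1
    ring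
  rw [h2, ← h]
  refine integral_congr_ae ?_
  filter_upwards [cmExt_smul t e] with m hm
  rw [hm]
  simp [mul_comm]

theorem map_prodMk_lineResid_cmExt (hμ : ∫ m, m ∂μ = 0) {e : CMSpace μ} (he : ‖e‖ = 1) :
    μ.map (fun m => (lineResid μ e m, cmExt μ e m)) =
      (μ.map (lineResid μ e)).prod (gaussianReal 0 1) := by
  have hψ : Orthonormal ℝ (fun _ : Fin 1 => e) := by
    rw [orthonormal_iff_ite]
    intro i j
    simp [Subsingleton.elim i j, he]
  have h := (indepFun_encoder_resid hμ hψ).symm.comp measurable_id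
    (by fun_prop : Measurable fun z : EuclideanSpace ℝ (Fin 1) => z 0)
  rw [← lineResid_eq] at h
  have := (indepFun_iff_map_prod_eq_prod_map_map (by fun_prop) (by fun_prop)).1 h
  rw [← map_cmExt hμ he]
  exact this

theorem measurePreserving_add_smul (hμ : ∫ m, m ∂μ = 0) {e : CMSpace μ} (he : ‖e‖ = 1) :
    MeasurePreserving (fun p : M × ℝ => p.1 + p.2 • cmEmb μ e)
      ((μ.map (lineResid μ e)).prod (gaussianReal 0 1)) μ := by
  have hm : Measurable fun p : M × ℝ => p.1 + p.2 • cmEmb μ e := by fun_prop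
  refine ⟨hm, ?_⟩
  rw [← map_prodMk_lineResid_cmExt hμ he, Measure.map_map hm (by fun_prop)]
  convert Measure.map_id
  ext m
  simp [lineResid]

end Law

/-! ### Absolutely continuous versions and their derivatives -/

theorem LipschitzWith.comp_absolutelyContinuousOnInterval {X Z : Type*} [PseudoMetricSpace X]
    [PseudoMetricSpace Z] {K : NNReal} {φ : X → Z} (hφ : LipschitzWith K φ) {f : ℝ → X} {a b : ℝ}
    (hf : AbsolutelyContinuousOnInterval f a b) :
    AbsolutelyContinuousOnInterval (fun t => φ (f t)) a b := by
  have h := Tendsto.const_mul (K : ℝ) hf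
  rw [mul_zero] at h
  refine squeeze_zero (fun E => Finset.sum_nonneg fun _ _ => dist_nonneg) (fun E => ?_) h
  rw [Finset.mul_sum]
  exact Finset.sum_le_sum fun i _ => hφ.dist_le_mul _ _

theorem ae_differentiableAt_of_absolutelyContinuous {f : ℝ → ℝ}
    (hf : ∀ a b, AbsolutelyContinuousOnInterval f a b) : ∀ᵐ t, DifferentiableAt ℝ f t := by
  have h : ∀ n : ℕ, ∀ᵐ t : ℝ, t ∈ Set.uIcc (-(n : ℝ)) n → DifferentiableAt ℝ f t := fun n =>
    (hf _ _).boundedVariationOn.ae_differentiableAt_of_mem_uIcc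
  filter_upwards [ae_all_iff.2 h] with t ht
  obtain ⟨n, hn⟩ := exists_nat_ge |t|
  refine ht n ?_
  rw [Set.uIcc_of_le (by linarith [abs_nonneg t])]
  exact abs_le.1 hn

/-- If `f` agrees almost everywhere with a function differentiable at `s`, agrees with it at `s`,
and its difference quotients at `s` converge, then the limit is the derivative. -/
theorem deriv_eq_of_ae_eq {f f' : ℝ → ℝ} (hff : ∀ᵐ t, f t = f' t) {s δ : ℝ}
    (hs : f s = f' s) (hd : DifferentiableAt ℝ f' s)
    (hδ : Tendsto (fun t => t⁻¹ * (f (s + t) - f s)) (𝓝[≠] 0) (𝓝 δ)) : deriv f' s = δ := by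
  have h1 : Tendsto (fun t => t⁻¹ * (f' (s + t) - f' s)) (𝓝[≠] 0) (𝓝 (deriv f' s)) := by
    simpa using hd.hasDerivAt.tendsto_slope_zero
  have hae : ∀ᵐ t : ℝ, f (s + t) = f' (s + t) ∧ t ≠ 0 := by
    have h2 : ∀ᵐ t : ℝ, f (s + t) = f' (s + t) :=
      (measurePreserving_add_left volume s).quasiMeasurePreserving.ae hff
    have h3 : ∀ᵐ t : ℝ, t ≠ 0 := by simp [ae_iff, measure_singleton]
    exact h2.and h3
  -- This set has full measure, hence is dense and accumulates at 0; both limits can be compared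
  -- along it.
  set S : Set ℝ := {t | f (s + t) = f' (s + t) ∧ t ≠ 0} with hS
  have hdense : Dense S := Measure.dense_of_ae hae
  have : (𝓝[S] (0 : ℝ)).NeBot := mem_closure_iff_nhdsWithin_neBot.1 (hdense 0)
  have hle : 𝓝[S] (0 : ℝ) ≤ 𝓝[≠] 0 := nhdsWithin_mono _ fun t ht => ht.2
  refine tendsto_nhds_unique ((h1.mono_left hle)) ((hδ.mono_left hle).congr' ?_)
  filter_upwards [self_mem_nhdsWithin] with t ht
  rw [ht.1, hs]

/-! ### The Poincaré inequality in one direction -/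

section Directional

variable {M : Type*} [NormedAddCommGroup M] [InnerProductSpace ℝ M] [CompleteSpace M]
  [SecondCountableTopology M] [MeasurableSpace M] [BorelSpace M]
  {μ : Measure M} [IsGaussian μ]

theorem sq_enorm_integral_le {Ω : Type*} [MeasurableSpace Ω] {P : Measure Ω}
    [IsProbabilityMeasure P] {f : Ω → ℝ} (hf : AEStronglyMeasurable f P) :
    ‖∫ x, f x ∂P‖ₑ ^ 2 ≤ ∫⁻ x, ‖f x‖ₑ ^ 2 ∂P := by
  have h1 : ‖∫ x, f x ∂P‖ₑ ≤ eLpNorm f 2 P :=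
    (enorm_integral_le_lintegral_enorm f).trans
      (by rw [← eLpNorm_one_eq_lintegral_enorm]; exact eLpNorm_le_eLpNorm_of_exponent_le one_le_two hf)
  calc _ ≤ eLpNorm f 2 P ^ 2 := by gcongr
    _ = _ := by
      have := eLpNorm_nnreal_pow_eq_lintegral (f := f) (μ := P) (p := 2) two_ne_zero
      simpa using this

theorem eLpNorm_two_sq {Ω E : Type*} [MeasurableSpace Ω] {P : Measure Ω} [NormedAddCommGroup E]
    (f : Ω → E) : eLpNorm f 2 P ^ 2 = ∫⁻ x, ‖f x‖ₑ ^ 2 ∂P := by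
  have := eLpNorm_nnreal_pow_eq_lintegral (f := f) (μ := P) (p := 2) two_ne_zero
  simpa using this

theorem memLp_two_iff_lintegral {Ω E : Type*} [MeasurableSpace Ω] {P : Measure Ω}
    [NormedAddCommGroup E] {f : Ω → E} (hf : AEStronglyMeasurable f P) :
    MemLp f 2 P ↔ ∫⁻ x, ‖f x‖ₑ ^ 2 ∂P < ∞ := by
  rw [← eLpNorm_two_sq, MemLp]
  simp [hf, ENNReal.pow_lt_top_iff]

theorem ae_memLp_two_prodMk_left {Ω₁ Ω₂ : Type*} [MeasurableSpace Ω₁] [MeasurableSpace Ω₂]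
    {P : Measure Ω₁} {Q : Measure Ω₂} [SFinite P] [SFinite Q] {f : Ω₁ × Ω₂ → ℝ}
    (hf : MemLp f 2 (P.prod Q)) : ∀ᵐ x ∂P, MemLp (fun y => f (x, y)) 2 Q := by
  have h1 := (memLp_two_iff_lintegral hf.1).1 hf
  have hm : AEMeasurable (fun p => ‖f p‖ₑ ^ 2) (P.prod Q) := hf.1.enorm.pow_const 2
  rw [lintegral_prod _ hm] at h1
  filter_upwards [ae_lt_top' hm.lintegral_prod_right' h1.ne, hf.1.prodMk_left] with x hx hx2
  exact (memLp_two_iff_lintegral hx2).2 hx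

theorem memLp_two_integral_prod {Ω₁ Ω₂ : Type*} [MeasurableSpace Ω₁] [MeasurableSpace Ω₂]
    {P : Measure Ω₁} {Q : Measure Ω₂} [SFinite P] [IsProbabilityMeasure Q] {f : Ω₁ × Ω₂ → ℝ}
    (hf : MemLp f 2 (P.prod Q)) : MemLp (fun x => ∫ y, f (x, y) ∂Q) 2 P := by
  have h1 := (memLp_two_iff_lintegral hf.1).1 hf
  have hm : AEMeasurable (fun p => ‖f p‖ₑ ^ 2) (P.prod Q) := hf.1.enorm.pow_const 2
  rw [memLp_two_iff_lintegral hf.1.integral_prod_right']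
  rw [lintegral_prod _ hm] at h1
  refine lt_of_le_of_lt (lintegral_mono_ae ?_) h1
  filter_upwards [hf.1.prodMk_left] with x hx
  exact sq_enorm_integral_le hx

theorem norm_toLp_sub_sq {Ω : Type*} [MeasurableSpace Ω] {P : Measure Ω} {f : Ω → ℝ}
    (hf : MemLp f 2 P) {g : Ω → ℝ} {G : Lp ℝ 2 P} (hg : G =ᵐ[P] g) :
    ENNReal.ofReal (‖hf.toLp f - G‖ ^ 2) = ∫⁻ x, ‖f x - g x‖ₑ ^ 2 ∂P := by
  rw [ENNReal.ofReal_pow (norm_nonneg _), ofReal_norm, Lp.enorm_def, eLpNorm_two_sq]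
  refine lintegral_congr_ae ?_
  filter_upwards [Lp.coeFn_sub (hf.toLp f) G, hf.coeFn_toLp, hg] with x h1 h2 h3
  rw [h1, Pi.sub_apply, h2, h3]

theorem norm_sub_starProjection_le {E : Type*} [NormedAddCommGroup E] [InnerProductSpace ℝ E]
    (U : Submodule ℝ E) [U.HasOrthogonalProjection] (y : E) {w : E} (hw : w ∈ U) :
    ‖y - U.starProjection y‖ ≤ ‖y - w‖ := by
  rw [U.starProjection_minimal]
  exact ciInf_le ⟨0, by rintro _ ⟨x, rfl⟩; exact norm_nonneg _⟩ (⟨w, hw⟩ : U)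

theorem inner_cmOf_sub (e : CMSpace μ) (k : M) : (fun m => inner ℝ k (lineResid μ e m)) =ᵐ[μ]
    cmExt μ (cmOf μ k - inner ℝ e (cmOf μ k) • e) := by
  filter_upwards [cmExt_sub (cmOf μ k) (inner ℝ e (cmOf μ k) • e), cmExt_cmOf (μ := μ) k,
    cmExt_smul (inner ℝ e (cmOf μ k)) e] with m h1 h2 h3
  rw [h1, Pi.sub_apply, h2, h3, lineResid, inner_sub_right, inner_smul_right, inner_cmEmb,
    real_inner_comm e]
  simp [mul_comm]

/-- The Poincaré inequality in one Cameron--Martin direction. -/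
theorem sq_norm_sub_starProjection_cosOrth_le (hμ : ∫ m, m ∂μ = 0) {e : CMSpace μ} (he : ‖e‖ = 1)
    {F F' d : M → ℝ} (hF : MemLp F 2 μ) (hd : AEStronglyMeasurable d μ)
    (hFd : ∀ᵐ m ∂μ,
      Tendsto (fun t : ℝ => t⁻¹ * (F (m + t • cmEmb μ e) - F m)) (𝓝[≠] 0) (𝓝 (d m)))
    (hFF : F' =ᵐ[μ] F)
    (hAC : ∀ m a b, AbsolutelyContinuousOnInterval (fun t : ℝ => F' (m + t • cmEmb μ e)) a b) :
    ENNReal.ofReal (‖hF.toLp F - (cosOrth μ e).starProjection (hF.toLp F)‖ ^ 2) ≤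
      ∫⁻ m, ‖d m‖ₑ ^ 2 ∂μ := by
  set ν := μ.map (lineResid μ e) with hν
  set γ := gaussianReal 0 1 with hγ
  have hprob : IsProbabilityMeasure ν := Measure.isProbabilityMeasure_map (by fun_prop)
  have hmp := measurePreserving_add_smul (μ := μ) hμ he
  have hFp : MemLp (fun p : M × ℝ => F (p.1 + p.2 • cmEmb μ e)) 2 (ν.prod γ) :=
    hF.comp_measurePreserving hmp
  -- The Gaussian average along the line through y; as a function of the residual it lies in
  -- `cosOrth μ e`, so it competes with the projection.
  set φ : M → ℝ := fun y => ∫ t, F (y + t • cmEmb μ e) ∂γ with hφdef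
  have hφ : MemLp φ 2 ν := memLp_two_integral_prod hFp
  have hmem : (hφ.comp_measurePreserving ((measurable_lineResid e).measurePreserving μ)).toLp _ ∈
      cosOrth μ e := by
    refine toLp_comp_mem_of_cos_mem (measurable_lineResid e)
      (Submodule.isClosed_topologicalClosure _) (fun k c => ?_) hφ
    have horth : inner ℝ e (cmOf μ k - inner ℝ e (cmOf μ k) • e) = 0 := by
      rw [inner_sub_right, inner_smul_right, real_inner_self_eq_norm_sq, he]; ring
    have heq : (memLp_cos (P := μ) (X := fun m => inner ℝ k (lineResid μ e m))
        (by fun_prop) c).toLp _ = cosLp μ (cmOf μ k - inner ℝ e (cmOf μ k) • e) c := by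
      refine MemLp.toLp_congr _ _ ?_
      filter_upwards [inner_cmOf_sub e k] with m hm
      rw [hm]
    rw [heq]
    exact cosLp_mem_cosOrth horth c
  have h1 : ENNReal.ofReal (‖hF.toLp F - (cosOrth μ e).starProjection (hF.toLp F)‖ ^ 2) ≤
      ∫⁻ m, ‖F m - φ (lineResid μ e m)‖ₑ ^ 2 ∂μ := by
    refine le_of_le_of_eq ?_ (norm_toLp_sub_sq hF (MemLp.coeFn_toLp
      (hφ.comp_measurePreserving ((measurable_lineResid e).measurePreserving μ))))
    gcongr
    exact norm_sub_starProjection_le _ _ hmem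
  refine h1.trans ?_
  -- Residual and coordinate along `e` are independent, so the integral disintegrates into lines.
  have h2 : ∫⁻ m, ‖F m - φ (lineResid μ e m)‖ₑ ^ 2 ∂μ =
      ∫⁻ y, ∫⁻ t, ‖F (y + t • cmEmb μ e) - φ y‖ₑ ^ 2 ∂γ ∂ν := by
    have hm : AEMeasurable (fun p : M × ℝ => ‖F (p.1 + p.2 • cmEmb μ e) - φ p.1‖ₑ ^ 2)
        (ν.prod γ) :=
      (hFp.1.sub (hφ.1.comp_fst)).enorm.pow_const 2
    rw [← lintegral_prod (fun p : M × ℝ => ‖F (p.1 + p.2 • cmEmb μ e) - φ p.1‖ₑ ^ 2) hm,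
      ← map_prodMk_lineResid_cmExt hμ he, lintegral_map' _ (by fun_prop)]
    · simp [lineResid]
    · rw [map_prodMk_lineResid_cmExt hμ he]
      exact hm
  have h3 : ∫⁻ m, ‖d m‖ₑ ^ 2 ∂μ = ∫⁻ y, ∫⁻ t, ‖d (y + t • cmEmb μ e)‖ₑ ^ 2 ∂γ ∂ν := by
    have hd2 : AEMeasurable (fun m => ‖d m‖ₑ ^ 2) μ := hd.enorm.pow_const 2
    have hd3 := hd2
    rw [← hmp.map_eq] at hd3
    rw [← lintegral_prod (fun p : M × ℝ => ‖d (p.1 + p.2 • cmEmb μ e)‖ₑ ^ 2)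
      (hd2.comp_quasiMeasurePreserving hmp.quasiMeasurePreserving), ← lintegral_map' hd3
        hmp.measurable.aemeasurable, hmp.map_eq]
  rw [h2, h3]
  have hae := Measure.ae_ae_of_ae_prod (hmp.quasiMeasurePreserving.ae (hFF.and hFd))
  refine lintegral_mono_ae ?_
  filter_upwards [hae, ae_memLp_two_prodMk_left hFp] with y hy hyL
  -- The Gaussian and Lebesgue measures share null sets, and both directions are needed: this one
  -- turns almost sure agreement of versions into Lebesgue agreement, the other transfers
  -- differentiability.
  have hvol : volume ≪ γ := gaussianReal_absolutelyContinuous' 0 one_ne_zero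
  set f' : ℝ → ℝ := fun t => F' (y + t • cmEmb μ e) with hf'
  have hff : ∀ᵐ t ∂γ, F (y + t • cmEmb μ e) = f' t := by
    filter_upwards [hy] with t ht using ht.1.symm
  have hfL : MemLp f' 2 γ := hyL.ae_eq hff
  have hint : φ y = ∫ t, f' t ∂γ := integral_congr_ae hff
  calc ∫⁻ t, ‖F (y + t • cmEmb μ e) - φ y‖ₑ ^ 2 ∂γ
      = ∫⁻ t, ‖f' t - ∫ t, f' t ∂γ‖ₑ ^ 2 ∂γ := by
        refine lintegral_congr_ae ?_
        filter_upwards [hff] with t ht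
        rw [ht, hint]
    _ ≤ ∫⁻ t, ‖deriv f' t‖ₑ ^ 2 ∂γ := gaussian_poincare (hAC y) hfL
    _ = ∫⁻ t, ‖d (y + t • cmEmb μ e)‖ₑ ^ 2 ∂γ := by
        refine lintegral_congr_ae ?_
        have hdiff : ∀ᵐ t ∂γ, DifferentiableAt ℝ f' t :=
          (gaussianReal_absolutelyContinuous 0 one_ne_zero).ae_le
            (ae_differentiableAt_of_absolutelyContinuous (hAC y))
        filter_upwards [hy, hdiff] with t ht htd
        rw [deriv_eq_of_ae_eq (f := fun t => F (y + t • cmEmb μ e)) (hvol.ae_le hff) ht.1.symm htd]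
        refine ht.2.congr fun s => ?_
        rw [add_smul, add_assoc]

end Directional

/-! ### From single directions to the complement of the reduced space -/

section Subspace

variable {M : Type*} [NormedAddCommGroup M] [InnerProductSpace ℝ M] [CompleteSpace M]
  [SecondCountableTopology M] [MeasurableSpace M] [BorelSpace M]
  {μ : Measure M} [IsGaussian μ] {r : ℕ} {ψ : Fin r → CMSpace μ}

/-- The square integrable functions of the encoder. -/
def encoderSubmodule (μ : Measure M) [IsGaussian μ] {r : ℕ} (ψ : Fin r → CMSpace μ) :
    Submodule ℝ (Lp ℝ 2 μ) where
  carrier := {w | ∃ φ : EuclideanSpace ℝ (Fin r) → ℝ, Measurable φ ∧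
    w =ᵐ[μ] fun m => φ (encoder μ ψ m)}
  add_mem' := by
    rintro a b ⟨φ, hφ, ha⟩ ⟨χ, hχ, hb⟩
    refine ⟨φ + χ, hφ.add hχ, ?_⟩
    filter_upwards [Lp.coeFn_add a b, ha, hb] with m h1 h2 h3
    rw [h1, Pi.add_apply, h2, h3, Pi.add_apply]
  zero_mem' := ⟨0, measurable_zero, Lp.coeFn_zero _ _ _⟩
  smul_mem' := by
    rintro c a ⟨φ, hφ, ha⟩
    refine ⟨c • φ, hφ.const_smul c, ?_⟩
    filter_upwards [Lp.coeFn_smul c a, ha] with m h1 h2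
    rw [h1, Pi.smul_apply, h2, Pi.smul_apply]

theorem cosLp_mem_encoderSubmodule (z : Fin r → ℝ) (c : ℝ) :
    cosLp μ (∑ j, z j • ψ j) c ∈ encoderSubmodule μ ψ := by
  refine ⟨fun x => Real.cos (∑ j, z j * x j + c), by fun_prop, ?_⟩
  filter_upwards [coeFn_cosLp (∑ j, z j • ψ j) c, cmExt_sum Finset.univ z ψ] with m h1 h2
  rw [h1, h2]
  rfl

/-- The reduced mapping is at least as good an approximation as any other function of the
encoder. -/
theorem lintegral_sub_reducedMap_le (hμ : ∫ m, m ∂μ = 0) (hψ : Orthonormal ℝ ψ)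
    {F : M → ℝ} (hF : MemLp F 2 μ) {w : Lp ℝ 2 μ} (hw : w ∈ encoderSubmodule μ ψ) :
    ∫⁻ m, ‖F m - ∫ m', F (mixArg μ ψ (encoder μ ψ m) m') ∂μ‖ₑ ^ 2 ∂μ ≤
      ENNReal.ofReal (‖hF.toLp F - w‖ ^ 2) := by
  obtain ⟨φ, hφ, hwφ⟩ := hw
  rw [norm_toLp_sub_sq hF hwφ]
  set σ := stdGaussian (EuclideanSpace ℝ (Fin r))
  set ρ := μ.map (resid μ ψ) with hρ
  have hprob : IsProbabilityMeasure ρ := Measure.isProbabilityMeasure_map (by fun_prop)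
  have hmp := measurePreserving_decoder_add hμ hψ
  have hFp : MemLp (fun p : EuclideanSpace ℝ (Fin r) × M => F (decoder μ ψ p.1 + p.2)) 2
      (σ.prod ρ) := hF.comp_measurePreserving hmp
  have hmem := ae_memLp_two_prodMk_left hFp
  set g : EuclideanSpace ℝ (Fin r) → ℝ := fun z => ∫ y, F (decoder μ ψ z + y) ∂ρ with hg
  have hgm : AEStronglyMeasurable g σ := hFp.1.integral_prod_right'
  have hgeq : ∀ᵐ z ∂σ, ∫ m', F (mixArg μ ψ z m') ∂μ = g z := by
    filter_upwards [hmem] with z hz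
    exact (integral_map measurable_resid.aemeasurable hz.1).symm
  -- For a fixed code, `χ` is a constant to be compared with a function of the residual; hence the
  -- optimal choice is the mean.
  have htrans : ∀ χ : EuclideanSpace ℝ (Fin r) → ℝ, AEStronglyMeasurable χ σ →
      ∫⁻ m, ‖F m - χ (encoder μ ψ m)‖ₑ ^ 2 ∂μ =
        ∫⁻ z, ∫⁻ y, ‖F (decoder μ ψ z + y) - χ z‖ₑ ^ 2 ∂ρ ∂σ := by
    intro χ hχ
    have hm : AEMeasurable (fun p : EuclideanSpace ℝ (Fin r) × M =>
        ‖F (decoder μ ψ p.1 + p.2) - χ p.1‖ₑ ^ 2) (σ.prod ρ) :=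
      (hFp.1.sub hχ.comp_fst).enorm.pow_const 2
    rw [← lintegral_prod (fun p : EuclideanSpace ℝ (Fin r) × M =>
        ‖F (decoder μ ψ p.1 + p.2) - χ p.1‖ₑ ^ 2) hm,
      ← map_prodMk_encoder_resid hμ hψ, lintegral_map' _ (by fun_prop)]
    · simp [decoder_encoder_add_resid]
    · rw [map_prodMk_encoder_resid hμ hψ]
      exact hm
  have hqe : ∀ᵐ m ∂μ, ∫ m', F (mixArg μ ψ (encoder μ ψ m) m') ∂μ = g (encoder μ ψ m) := by
    have hgeq' : ∀ᵐ z ∂μ.map (encoder μ ψ), ∫ m', F (mixArg μ ψ z m') ∂μ = g z := by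
      rwa [map_encoder hμ hψ]
    exact ae_of_ae_map (by fun_prop) hgeq'
  calc ∫⁻ m, ‖F m - ∫ m', F (mixArg μ ψ (encoder μ ψ m) m') ∂μ‖ₑ ^ 2 ∂μ
      = ∫⁻ m, ‖F m - g (encoder μ ψ m)‖ₑ ^ 2 ∂μ := by
        refine lintegral_congr_ae ?_
        filter_upwards [hqe] with m hm
        rw [hm]
    _ = ∫⁻ z, ∫⁻ y, ‖F (decoder μ ψ z + y) - g z‖ₑ ^ 2 ∂ρ ∂σ := htrans g hgm
    _ ≤ ∫⁻ z, ∫⁻ y, ‖F (decoder μ ψ z + y) - φ z‖ₑ ^ 2 ∂ρ ∂σ := by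
        refine lintegral_mono_ae ?_
        filter_upwards [hmem] with z hz
        exact lintegral_sq_enorm_sub_integral_le hz (φ z)
    _ = _ := (htrans φ hφ.aestronglyMeasurable).symm

/-- The span of the cosines is dense in `L²(μ)`. -/
theorem dense_span_cosLp :
    (Submodule.span ℝ {F | ∃ (h : CMSpace μ) (c : ℝ), F = cosLp μ h c}).topologicalClosure = ⊤ := by
  refine submodule_eq_top_of_cos_mem (Submodule.isClosed_topologicalClosure _) fun k c => ?_
  have heq : (memLp_cos (P := μ) (X := fun m => inner ℝ k m) (by fun_prop) c).toLp _ =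
      cosLp μ (cmOf μ k) c := by
    refine MemLp.toLp_congr _ _ ?_
    filter_upwards [cmExt_cmOf (μ := μ) k] with m hm
    rw [hm]
  rw [heq]
  exact Submodule.le_topologicalClosure _ (Submodule.subset_span ⟨_, _, rfl⟩)

/-- The Poincaré inequality for the best approximation by functions of the encoder, in terms of
the one-directional averages. -/
theorem lintegral_sub_reducedMap_le_of_sum_le (hμ : ∫ m, m ∂μ = 0) (hψ : Orthonormal ℝ ψ)
    {ι : Type*} {e : ι → CMSpace μ} (he : Orthonormal ℝ e)
    (hsum : ∀ h : CMSpace μ, HasSum (fun i => inner ℝ (e i) h • e i)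
      (h - ∑ j, inner ℝ (ψ j) h • ψ j))
    {F : M → ℝ} (hF : MemLp F 2 μ) {C : ℝ} (hC : 0 ≤ C)
    (hle : ∀ s : Finset ι,
      ∑ i ∈ s, ‖hF.toLp F - (cosOrth μ (e i)).starProjection (hF.toLp F)‖ ^ 2 ≤ C) :
    ∫⁻ m, ‖F m - ∫ m', F (mixArg μ ψ (encoder μ ψ m) m') ∂μ‖ₑ ^ 2 ∂μ ≤ ENNReal.ofReal C := by
  choose P hP1 hP2 hP3 using fun s => exists_finset_average hμ he s
  -- Convergence is shown only on combinations of cosines, where the averages are explicit; the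
  -- limit retains only the reduced directions.
  have hlim : ∀ p ∈ Submodule.span ℝ {F | ∃ (h : CMSpace μ) (c : ℝ), F = cosLp μ h c},
      ∃ w ∈ encoderSubmodule μ ψ, Tendsto (fun s => P s p) atTop (𝓝 w) := by
    intro p hp
    induction hp using Submodule.span_induction with
    | mem p hp =>
      obtain ⟨h, c, rfl⟩ := hp
      have h1 := hsum h
      have h2 : HasSum (fun i => (inner ℝ (e i) h) ^ 2)
          (inner ℝ h (h - ∑ j, inner ℝ (ψ j) h • ψ j)) := by
        have h3 : (fun i => (inner ℝ (e i) h) ^ 2) =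
            fun i => innerSL ℝ h (inner ℝ (e i) h • e i) := funext fun i => by
          rw [innerSL_apply_apply, inner_smul_right, real_inner_comm (e i) h, sq]
        rw [h3]
        exact h1.mapL (innerSL ℝ h)
      refine ⟨Real.exp (-(inner ℝ h (h - ∑ j, inner ℝ (ψ j) h • ψ j)) / 2) •
        cosLp μ (∑ j, inner ℝ (ψ j) h • ψ j) c,
        Submodule.smul_mem _ _ (cosLp_mem_encoderSubmodule _ c), ?_⟩
      simp_rw [hP3]
      refine Tendsto.smul ?_ ?_
      · exact (Real.continuous_exp.tendsto _).comp ((Tendsto.neg h2).div_const 2)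
      · refine ((continuous_cosLp c).tendsto _).comp ?_
        have := tendsto_const_nhds (x := h).sub h1
        rwa [sub_sub_cancel] at this
    | zero => exact ⟨0, Submodule.zero_mem _, by simp⟩
    | add p q _ _ hp hq =>
      obtain ⟨v, hv, hpv⟩ := hp
      obtain ⟨w, hw, hqw⟩ := hq
      refine ⟨v + w, Submodule.add_mem _ hv hw, ?_⟩
      simp_rw [map_add]
      exact hpv.add hqw
    | smul a p _ hp =>
      obtain ⟨v, hv, hpv⟩ := hp
      refine ⟨a • v, Submodule.smul_mem _ _ hv, ?_⟩
      simp_rw [map_smul]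
      exact hpv.const_smul a
  -- One ε pays for replacing F by a combination of cosines under the contraction `P s`, the other
  -- for stopping at a finite `s`.
  have hdist : ∀ ε > 0, ∃ w ∈ encoderSubmodule μ ψ, ‖hF.toLp F - w‖ ≤ √C + 2 * ε := by
    intro ε hε
    have hmem : hF.toLp F ∈ (Submodule.span ℝ {F | ∃ (h : CMSpace μ) (c : ℝ),
        F = cosLp μ h c}).topologicalClosure := dense_span_cosLp (μ := μ) ▸ Submodule.mem_top
    obtain ⟨p, hp, hpF⟩ := Metric.mem_closure_iff.1 hmem ε hε
    obtain ⟨w, hw, hpw⟩ := hlim p hp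
    refine ⟨w, hw, ?_⟩
    obtain ⟨s, hs⟩ := (Metric.tendsto_nhds.1 hpw ε hε).exists
    rw [dist_eq_norm] at hs hpF
    have h1 : ‖hF.toLp F - P s (hF.toLp F)‖ ≤ √C := Real.le_sqrt_of_sq_le ((hP2 s _).trans (hle s))
    have h2 : ‖P s (hF.toLp F) - P s p‖ ≤ ε := by
      rw [← map_sub]
      exact (hP1 s _).trans hpF.le
    calc ‖hF.toLp F - w‖
        = ‖(hF.toLp F - P s (hF.toLp F)) + (P s (hF.toLp F) - P s p) + (P s p - w)‖ := by
          congr 1; abel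
      _ ≤ √C + ε + ε := (norm_add₃_le).trans (add_le_add (add_le_add h1 h2) hs.le)
      _ = √C + 2 * ε := by ring
  have hcont : Tendsto (fun ε : ℝ => ENNReal.ofReal ((√C + 2 * ε) ^ 2)) (𝓝[>] 0)
      (𝓝 (ENNReal.ofReal C)) := by
    have h0 : Continuous fun ε : ℝ => ENNReal.ofReal ((√C + 2 * ε) ^ 2) :=
      ENNReal.continuous_ofReal.comp (by fun_prop)
    have := h0.tendsto 0
    simp only [mul_zero, add_zero, Real.sq_sqrt hC] at this
    exact this.mono_left nhdsWithin_le_nhds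
  refine ge_of_tendsto hcont ?_
  filter_upwards [self_mem_nhdsWithin] with ε hε
  obtain ⟨w, hw, hwF⟩ := hdist ε hε
  refine (lintegral_sub_reducedMap_le hμ hψ hF hw).trans ?_
  gcongr

theorem lintegral_sub_reducedMap_le_of_forall_sum_le (hμ : ∫ m, m ∂μ = 0) (hψ : Orthonormal ℝ ψ)
    {ι : Type*} {e : ι → CMSpace μ} (he : Orthonormal ℝ e)
    (hsum : ∀ h : CMSpace μ, HasSum (fun i => inner ℝ (e i) h • e i)
      (h - ∑ j, inner ℝ (ψ j) h • ψ j))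
    {F : M → ℝ} (hF : MemLp F 2 μ) {c : ι → ℝ≥0∞}
    (hle : ∀ i, ENNReal.ofReal
      (‖hF.toLp F - (cosOrth μ (e i)).starProjection (hF.toLp F)‖ ^ 2) ≤ c i) :
    ∫⁻ m, ‖F m - ∫ m', F (mixArg μ ψ (encoder μ ψ m) m') ∂μ‖ₑ ^ 2 ∂μ ≤ ∑' i, c i := by
  by_cases hC : ∑' i, c i = ∞
  · rw [hC]; exact le_top
  rw [← ENNReal.ofReal_toReal hC]
  refine lintegral_sub_reducedMap_le_of_sum_le hμ hψ he hsum hF ENNReal.toReal_nonneg fun s => ?_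
  rw [← ENNReal.ofReal_le_iff_le_toReal hC, ENNReal.ofReal_sum_of_nonneg fun _ _ => sq_nonneg _]
  exact (Finset.sum_le_sum fun i _ => hle i).trans (ENNReal.sum_le_tsum s)

end Subspace

/-! ### Trace inequalities and perturbation of eigenspaces -/

section Spectral

variable {H : Type*} [NormedAddCommGroup H] [InnerProductSpace ℝ H] [CompleteSpace H]

theorem Orthonormal.exists_complement_basis.{u} {H : Type u} [NormedAddCommGroup H]
    [InnerProductSpace ℝ H] [CompleteSpace H] {r : ℕ} {ψ : Fin r → H} (hψ : Orthonormal ℝ ψ) :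
    ∃ (ι : Type u) (e : ι → H), Orthonormal ℝ (Sum.elim ψ e) ∧
      ∀ h : H, HasSum (fun i => inner ℝ (e i) h • e i) (h - ∑ j, inner ℝ (ψ j) h • ψ j) := by
  classical
  set K := (Submodule.span ℝ (Set.range ψ))ᗮ with hK
  have hKψ : ∀ (u : K) (j : Fin r), inner ℝ (ψ j) (u : H) = 0 := fun u j =>
    (Submodule.mem_orthogonal _ _).1 u.2 _ (Submodule.subset_span ⟨j, rfl⟩)
  obtain ⟨w, b, -⟩ := exists_hilbertBasis ℝ K
  refine ⟨w, fun i => b i, ?_, fun h => ?_⟩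
  · have heo := b.orthonormal
    rw [orthonormal_iff_ite] at heo hψ ⊢
    rintro (i | i) (j | j)
    · simpa using hψ i j
    · simpa using hKψ (b j) i
    · rw [real_inner_comm]
      simpa using hKψ (b i) j
    · simpa [Sum.inr.injEq] using heo i j
  · have hu : h - ∑ j, inner ℝ (ψ j) h • ψ j ∈ K := by
      rw [hK, Submodule.mem_orthogonal]
      intro x hx
      induction hx using Submodule.span_induction with
      | mem x hx =>
        obtain ⟨j, rfl⟩ := hx
        rw [inner_sub_right, hψ.inner_right_fintype, sub_self]
      | zero => simp
      | add x y _ _ hx hy => rw [inner_add_left, hx, hy, add_zero]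
      | smul c x _ hx => rw [inner_smul_left, hx, mul_zero]
    have h1 := (b.hasSum_repr ⟨_, hu⟩).mapL K.subtypeL
    have h2 : ∀ i, inner ℝ (b i : H) h = b.repr ⟨_, hu⟩ i := fun i => by
      rw [b.repr_apply_apply, Submodule.coe_inner, inner_sub_right, inner_sum]
      simp only [inner_smul_right]
      rw [Finset.sum_eq_zero fun j _ => by
        rw [real_inner_comm (ψ j) (b i : H), hKψ, mul_zero], sub_zero]
    simp_rw [h2]
    exact h1

namespace IsEigensystem

variable {T : H →L[ℝ] H} {N : ℕ∞} {lam : ℕ → ℝ} {ψ : ℕ → H}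

/-- Extend the eigenvectors to a Hilbert basis. The added vectors are orthogonal to them, so `T`
kills these by fullness; self-adjointness is not involved. -/
theorem hasSum_inner (hT : IsEigensystem T N lam ψ) (h : H) :
    HasSum (fun j => lam j * inner ℝ (ψ j) h ^ 2) (inner ℝ h (T h)) := by
  have hinj := hT.orthonormal.linearIndependent.injective
  obtain ⟨w, b, hw, hb⟩ := hT.orthonormal.toSubtypeRange.exists_hilbertBasis_extension
  have h1 := (b.hasSum_repr h).mapL ((innerSL ℝ h).comp T)
  set i : {j : ℕ // (j : ℕ∞) < N} → w := fun j => ⟨ψ j, hw ⟨j, rfl⟩⟩ with hi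
  have hbi : ∀ x : w, b x = x := fun x => congrFun hb x
  have hiinj : Function.Injective i := fun j k hjk => hinj (congrArg Subtype.val hjk)
  have hzero : ∀ x ∉ Set.range i,
      ((innerSL ℝ h).comp T) (b.repr h x • b x) = 0 := by
    intro x hx
    have : T (b x) = 0 := by
      refine hT.complete _ fun j hj => ?_
      have hne : i ⟨j, hj⟩ ≠ x := fun hjx => hx ⟨_, hjx⟩
      have := b.orthonormal.2 hne
      simp only [hbi] at this ⊢
      exact this
    rw [map_smul, ContinuousLinearMap.comp_apply, this, map_zero, smul_zero]
  rw [← hiinj.hasSum_iff hzero] at h1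
  have h2 : HasSum (fun j : {j : ℕ // (j : ℕ∞) < N} => lam j * inner ℝ (ψ j) h ^ 2)
      (inner ℝ h (T h)) := by
    have h3 : (fun j : {j : ℕ // (j : ℕ∞) < N} => lam j * inner ℝ (ψ j) h ^ 2) =
        (fun x => ((innerSL ℝ h).comp T) (b.repr h x • b x)) ∘ i := funext fun j => by
      simp only [Function.comp_apply, map_smul, b.repr_apply_apply, hbi, hi,
        ContinuousLinearMap.comp_apply, hT.eigen j j.2, smul_eq_mul, innerSL_apply_apply]
      rw [inner_smul_right, real_inner_comm]
      ring
    rw [h3]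
    exact h1
  refine (Function.Injective.hasSum_iff Subtype.val_injective fun j hj => ?_).1 h2
  have : N ≤ j := by simpa using hj
  rw [hT.eq_zero j this, zero_mul]

/-- The trace inequality: the compression of `T` to a subspace has at most the trace of `T`. -/
theorem sum_inner_le_tsum (hT : IsEigensystem T N lam ψ) (hlam : Summable lam)
    {ι : Type*} {φ : ι → H} (hφ : Orthonormal ℝ φ) (s : Finset ι) :
    ∑ i ∈ s, inner ℝ (φ i) (T (φ i)) ≤ ∑' j, lam j := by
  have h1 := hasSum_sum fun i (_ : i ∈ s) => hT.hasSum_inner (φ i)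
  refine hasSum_le (fun j => ?_) h1 hlam.hasSum
  rw [← Finset.mul_sum]
  rcases lt_or_ge (j : ℕ∞) N with hj | hj
  · have h2 := hφ.sum_inner_products_le (x := ψ j) (s := s)
    have h3 : ‖ψ j‖ = 1 := hT.orthonormal.1 ⟨j, hj⟩
    rw [h3, one_pow] at h2
    refine mul_le_of_le_one_right (hT.nonneg j) (le_trans (le_of_eq ?_) h2)
    exact Finset.sum_congr rfl fun i _ => by rw [real_inner_comm, Real.norm_eq_abs, sq_abs]
  · rw [hT.eq_zero j hj, zero_mul]

/-- Ky Fan's maximum principle. -/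
theorem sum_inner_le_sum_range (hT : IsEigensystem T N lam ψ) {ι : Type*} {φ : ι → H}
    (hφ : Orthonormal ℝ φ) {s : Finset ι} {r : ℕ} (hs : s.card ≤ r) :
    ∑ i ∈ s, inner ℝ (φ i) (T (φ i)) ≤ ∑ j ∈ Finset.range r, lam j := by
  classical
  -- The weights on the eigenvalues. Bessel for `φ` gives at most 1 each, Bessel for `ψ` gives total
  -- at most `r`.
  set w : ℕ → ℝ := fun j => if (j : ℕ∞) < N then ∑ i ∈ s, inner ℝ (ψ j) (φ i) ^ 2 else 0 with hw
  have h1 : HasSum (fun j => lam j * w j) (∑ i ∈ s, inner ℝ (φ i) (T (φ i))) := by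
    have h2 : (fun j => lam j * w j) = fun j => ∑ i ∈ s, lam j * inner ℝ (ψ j) (φ i) ^ 2 :=
      funext fun j => by
        rw [← Finset.mul_sum]
        simp only [hw]
        split_ifs with hj
        · rfl
        · rw [hT.eq_zero j (not_lt.1 hj), zero_mul, zero_mul]
    rw [h2]
    exact hasSum_sum fun i _ => hT.hasSum_inner (φ i)
  have hw0 : ∀ j, 0 ≤ w j := fun j => by
    simp only [hw]; split_ifs
    · positivity
    · exact le_rfl
  have hw1 : ∀ j, w j ≤ 1 := fun j => by
    simp only [hw]; split_ifs with hj
    · have h2 := hφ.sum_inner_products_le (x := ψ j) (s := s)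
      have h3 : ‖ψ j‖ = 1 := hT.orthonormal.1 ⟨j, hj⟩
      rw [h3, one_pow] at h2
      refine le_trans (le_of_eq ?_) h2
      exact Finset.sum_congr rfl fun i _ => by rw [real_inner_comm, Real.norm_eq_abs, sq_abs]
    · exact zero_le_one
  have hwsum : ∀ t : Finset ℕ, ∑ j ∈ t, w j ≤ r := by
    intro t
    have h2 : ∀ i ∈ s, ∑ j ∈ t.subtype (fun j : ℕ => (j : ℕ∞) < N), inner ℝ (ψ j) (φ i) ^ 2 ≤ 1 := by
      intro i _
      have h3 := hT.orthonormal.sum_inner_products_le (x := φ i)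
        (s := t.subtype (fun j : ℕ => (j : ℕ∞) < N))
      rw [hφ.1 i, one_pow] at h3
      refine le_trans (le_of_eq ?_) h3
      exact Finset.sum_congr rfl fun i _ => by rw [Real.norm_eq_abs, sq_abs]
    calc ∑ j ∈ t, w j = ∑ j ∈ t.subtype (fun j : ℕ => (j : ℕ∞) < N),
          ∑ i ∈ s, inner ℝ (ψ j) (φ i) ^ 2 := by
          rw [Finset.sum_subtype_eq_sum_filter
            (f := fun j : ℕ => ∑ i ∈ s, inner ℝ (ψ j) (φ i) ^ 2), Finset.sum_filter]
      _ = ∑ i ∈ s, ∑ j ∈ t.subtype (fun j : ℕ => (j : ℕ∞) < N), inner ℝ (ψ j) (φ i) ^ 2 :=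
          Finset.sum_comm
      _ ≤ ∑ i ∈ s, 1 := Finset.sum_le_sum h2
      _ ≤ r := by simpa using hs
  refine hasSum_le_of_sum_le h1 fun t => ?_
  -- Bathtub argument with threshold `lam r`: weight is worth more than the threshold only below
  -- index `r`, where it is at most 1.
  have hpt : ∀ j ∈ t, lam j * w j ≤ lam r * w j + if j ∈ Finset.range r then lam j - lam r else 0 := by
    intro j _
    split_ifs with hj
    · have : lam r ≤ lam j := hT.antitone (Finset.mem_range.1 hj).le
      nlinarith [hw1 j]
    · have : lam j ≤ lam r := hT.antitone (by simpa using hj)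
      nlinarith [hw0 j]
  calc ∑ j ∈ t, lam j * w j
      ≤ ∑ j ∈ t, (lam r * w j + if j ∈ Finset.range r then lam j - lam r else 0) :=
        Finset.sum_le_sum hpt
    _ = lam r * ∑ j ∈ t, w j + ∑ j ∈ t with j ∈ Finset.range r, (lam j - lam r) := by
        rw [Finset.sum_add_distrib, Finset.mul_sum, Finset.sum_filter]
    _ ≤ lam r * r + ∑ j ∈ Finset.range r, (lam j - lam r) := by
        refine add_le_add (mul_le_mul_of_nonneg_left (hwsum t) (hT.nonneg r)) ?_
        refine Finset.sum_le_sum_of_subset_of_nonneg (fun j hj => (Finset.mem_filter.1 hj).2)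
          fun j hj _ => sub_nonneg.2 (hT.antitone (Finset.mem_range.1 hj).le)
    _ = ∑ j ∈ Finset.range r, lam j := by
        rw [Finset.sum_sub_distrib]
        simp; ring

theorem eigenvalue_eq (hT : IsEigensystem T N lam ψ) {j : ℕ} (hj : (j : ℕ∞) < N) :
    lam j = inner ℝ (ψ j) (T (ψ j)) := by
  have h3 : ‖ψ j‖ = 1 := hT.orthonormal.1 ⟨j, hj⟩
  rw [hT.eigen j hj, inner_smul_right, real_inner_self_eq_norm_sq, h3]
  ring

theorem sum_range_eq (hT : IsEigensystem T N lam ψ) (r : ℕ) :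
    ∑ j ∈ Finset.range r, lam j =
      ∑ j ∈ (Finset.range r).subtype (fun j : ℕ => (j : ℕ∞) < N), inner ℝ (ψ j) (T (ψ j)) := by
  rw [Finset.sum_subtype_eq_sum_filter (f := fun j : ℕ => inner ℝ (ψ j) (T (ψ j))),
    Finset.sum_filter]
  refine Finset.sum_congr rfl fun j _ => ?_
  split_ifs with hj
  · exact hT.eigenvalue_eq hj
  · exact hT.eq_zero j (not_lt.1 hj)

theorem orthonormal_fin (hT : IsEigensystem T N lam ψ) {r : ℕ} (hr : (r : ℕ∞) ≤ N) :
    Orthonormal ℝ (fun j : Fin r => ψ j) :=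
  hT.orthonormal.comp
    (fun j : Fin r => (⟨j, lt_of_lt_of_le (by exact_mod_cast j.2) hr⟩ : {j : ℕ // (j : ℕ∞) < N}))
    fun i j hij => Fin.ext (by simpa using hij)

end IsEigensystem

theorem inner_apply_le_opNorm (A : H →L[ℝ] H) {x : H} (hx : ‖x‖ = 1) :
    inner ℝ x (A x) ≤ ‖A‖ := by
  have := (real_inner_le_norm x (A x)).trans (mul_le_mul_of_nonneg_left (A.le_opNorm x) (norm_nonneg x))
  simpa [hx] using this

/-- The trace of `T` off the span of the leading eigenvectors of a perturbation `S`. -/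
theorem sum_inner_complement_le {T S : H →L[ℝ] H} {N N' : ℕ∞} {lam lam' : ℕ → ℝ} {ψ ψ' : ℕ → H}
    (hT : IsEigensystem T N lam ψ) (hS : IsEigensystem S N' lam' ψ') (hlam : Summable lam)
    {r : ℕ} (hr : (r : ℕ∞) ≤ N') {ι : Type*} {e : ι → H}
    (he : Orthonormal ℝ (Sum.elim (fun j : Fin r => ψ' j) e)) (s : Finset ι) :
    ∑ i ∈ s, inner ℝ (e i) (T (e i)) ≤ (∑' j, lam (r + j)) + 2 * r * ‖T - S‖ := by
  -- The trace inequality is applied to the leading eigenvectors of `S` together with `e`.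
  have h1 := hT.sum_inner_le_tsum hlam he (Finset.disjSum Finset.univ s)
  rw [Finset.sum_disjSum] at h1
  simp only [Sum.elim_inl, Sum.elim_inr] at h1
  have h2 := hlam.sum_add_tsum_nat_add r
  simp_rw [add_comm _ r] at h2
  have hsplit : ∀ x : H, inner ℝ x (T x) = inner ℝ x (S x) + inner ℝ x ((T - S) x) := fun x => by
    rw [sub_apply, inner_sub_right]; ring
  have hsplit' : ∀ x : H, inner ℝ x (S x) = inner ℝ x (T x) + inner ℝ x ((S - T) x) := fun x => by
    rw [sub_apply, inner_sub_right]; ring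
  -- `T` may list fewer than `r` eigenvectors; only the existing ones are tested.
  set t := (Finset.range r).subtype (fun j : ℕ => (j : ℕ∞) < N) with ht
  have hcard : t.card ≤ r := by
    rw [ht, Finset.card_subtype]
    exact (Finset.card_filter_le _ _).trans (by simp)
  have h3 : ∑ j ∈ Finset.range r, lam j ≤ ∑ j ∈ Finset.range r, lam' j + r * ‖T - S‖ := by
    rw [hT.sum_range_eq]
    simp_rw [hsplit]
    rw [Finset.sum_add_distrib]
    refine add_le_add (hS.sum_inner_le_sum_range hT.orthonormal hcard) ?_
    calc _ ≤ ∑ j ∈ t, ‖T - S‖ :=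
          Finset.sum_le_sum fun j _ => inner_apply_le_opNorm _ (hT.orthonormal.1 j)
      _ ≤ r * ‖T - S‖ := by
          rw [Finset.sum_const, nsmul_eq_mul]
          gcongr
  have h4 : ∑ j ∈ Finset.range r, lam' j ≤
      ∑ j : Fin r, inner ℝ (ψ' j) (T (ψ' j)) + r * ‖T - S‖ := by
    rw [Finset.sum_range]
    have : ∀ j : Fin r, lam' j = inner ℝ (ψ' j) (T (ψ' j)) + inner ℝ (ψ' j) ((S - T) (ψ' j)) := by
      intro j
      rw [← hsplit']
      exact hS.eigenvalue_eq (lt_of_lt_of_le (by exact_mod_cast j.2) hr)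
    simp_rw [this]
    rw [Finset.sum_add_distrib]
    gcongr
    calc _ ≤ ∑ j : Fin r, ‖S - T‖ :=
          Finset.sum_le_sum fun j _ => inner_apply_le_opNorm _ ((hS.orthonormal_fin hr).1 j)
      _ = r * ‖T - S‖ := by simp [norm_sub_rev]
  linarith

end Spectral

/-! ### Hilbert-Schmidt norms into a finite-dimensional space -/

section HilbertSchmidt

variable {H : Type*} [NormedAddCommGroup H] [InnerProductSpace ℝ H] [CompleteSpace H]
  {Y : Type*} [NormedAddCommGroup Y] [InnerProductSpace ℝ Y] [CompleteSpace Y]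
  {κ : Type*} [Fintype κ]

theorem OrthonormalBasis.sum_sq_enorm_inner (V : OrthonormalBasis κ ℝ Y) (y : Y) :
    ∑ a, ‖inner ℝ (V a) y‖ₑ ^ 2 = ‖y‖ₑ ^ 2 := by
  simp_rw [← ofReal_norm, ← ENNReal.ofReal_pow (norm_nonneg _)]
  rw [← ENNReal.ofReal_sum_of_nonneg fun _ _ => sq_nonneg _, V.sum_sq_norm_inner_right]

theorem HilbertBasis.tsum_sq_enorm_inner {ι : Type*} (b : HilbertBasis ι ℝ H) (u : H) :
    ∑' i, ‖inner ℝ u (b i)‖ₑ ^ 2 = ‖u‖ₑ ^ 2 := by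
  have h := b.hasSum_inner_mul_inner u u
  have h2 : ∀ i, inner ℝ u (b i) * inner ℝ (b i) u = ‖inner ℝ u (b i)‖ ^ 2 := fun i => by
    rw [real_inner_comm u, Real.norm_eq_abs, sq_abs, sq]
  simp_rw [h2] at h
  simp_rw [← ofReal_norm, ← ENNReal.ofReal_pow (norm_nonneg _)]
  rw [← ENNReal.ofReal_tsum_of_nonneg (fun _ => sq_nonneg _) h.summable, h.tsum_eq,
    real_inner_self_eq_norm_sq]

/-- Parseval in both spaces moves the norm to the adjoint, which eliminates the chosen basis of the
domain. -/
theorem hsNormSq_eq (V : OrthonormalBasis κ ℝ Y) (T : H →L[ℝ] Y) :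
    hsNormSq T = ∑ a, ‖ContinuousLinearMap.adjoint T (V a)‖ₑ ^ 2 := by
  rw [hsNormSq]
  simp_rw [← V.sum_sq_enorm_inner (T _), ← ContinuousLinearMap.adjoint_inner_left]
  rw [Summable.tsum_finsetSum fun _ _ => ENNReal.summable]
  exact Finset.sum_congr rfl fun a _ => HilbertBasis.tsum_sq_enorm_inner _ _

/-- Bessel's inequality for each of the vectors T*V_a. -/
theorem sum_sq_enorm_apply_le_hsNormSq (V : OrthonormalBasis κ ℝ Y) (T : H →L[ℝ] Y)
    {ι : Type*} {φ : ι → H} (hφ : Orthonormal ℝ φ) (s : Finset ι) :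
    ∑ i ∈ s, ‖T (φ i)‖ₑ ^ 2 ≤ hsNormSq T := by
  rw [hsNormSq_eq V]
  simp_rw [← V.sum_sq_enorm_inner (T _), ← ContinuousLinearMap.adjoint_inner_left]
  rw [Finset.sum_comm]
  refine Finset.sum_le_sum fun a _ => ?_
  simp_rw [← ofReal_norm, ← ENNReal.ofReal_pow (norm_nonneg _)]
  rw [← ENNReal.ofReal_sum_of_nonneg fun _ _ => sq_nonneg _]
  refine ENNReal.ofReal_le_ofReal ?_
  simp_rw [fun i => real_inner_comm (φ i) (ContinuousLinearMap.adjoint T (V a))]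
  exact hφ.sum_inner_products_le _

theorem sq_enorm_le_hsNormSq (V : OrthonormalBasis κ ℝ Y) (T : H →L[ℝ] Y) :
    ‖T‖ₑ ^ 2 ≤ hsNormSq T := by
  by_cases hT : hsNormSq T = ∞
  · rw [hT]; exact le_top
  have hle : ‖T‖ ≤ √(hsNormSq T).toReal := by
    refine T.opNorm_le_bound (Real.sqrt_nonneg _) fun x => ?_
    by_cases hx : x = 0
    · simp [hx]
    have hx' : ‖x‖ ≠ 0 := norm_ne_zero_iff.2 hx
    have hon : Orthonormal ℝ (fun _ : Unit => ‖x‖⁻¹ • x) := by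
      rw [orthonormal_iff_ite]
      intro i j
      simp [norm_smul, hx']
    have h1 := sum_sq_enorm_apply_le_hsNormSq V T hon Finset.univ
    simp only [Finset.univ_unique, Finset.sum_const, Finset.card_singleton, one_smul] at h1
    rw [← ofReal_norm, ← ENNReal.ofReal_pow (norm_nonneg _),
      ENNReal.ofReal_le_iff_le_toReal hT] at h1
    have h2 := Real.le_sqrt_of_sq_le h1
    rw [map_smul, norm_smul, norm_inv, norm_norm, inv_mul_le_iff₀ (by positivity)] at h2
    linarith
  rw [← ofReal_norm, ← ENNReal.ofReal_pow (norm_nonneg _), ENNReal.ofReal_le_iff_le_toReal hT]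
  calc ‖T‖ ^ 2 ≤ √(hsNormSq T).toReal ^ 2 := by gcongr
    _ = _ := Real.sq_sqrt ENNReal.toReal_nonneg

end HilbertSchmidt

/-! ### The expected ppGNH and the subspace Poincaré inequality -/

section Main

variable {M : Type*} [NormedAddCommGroup M] [InnerProductSpace ℝ M] [CompleteSpace M]
  [SecondCountableTopology M] [MeasurableSpace M] [BorelSpace M]
  {μ : Measure M} [IsGaussian μ]
  {Y : Type*} [NormedAddCommGroup Y] [InnerProductSpace ℝ Y] [CompleteSpace Y]
  {κ : Type*} [Fintype κ]
  {G : M → Y} {D : M → CMSpace μ →L[ℝ] Y}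

theorem OrthonormalBasis.sum_lintegral_sq_enorm_inner {Ω : Type*} [MeasurableSpace Ω]
    {P : Measure Ω} (V : OrthonormalBasis κ ℝ Y) {u : Ω → Y} (hu : AEStronglyMeasurable u P) :
    ∑ a, ∫⁻ x, ‖inner ℝ (V a) (u x)‖ₑ ^ 2 ∂P = ∫⁻ x, ‖u x‖ₑ ^ 2 ∂P := by
  have hm : ∀ a, AEMeasurable (fun x => ‖inner ℝ (V a) (u x)‖ₑ ^ 2) P := fun a =>
    ((innerSL ℝ (V a)).continuous.comp_aestronglyMeasurable hu).enorm.pow_const 2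
  rw [← lintegral_finsetSum' _ fun a _ => hm a]
  simp_rw [V.sum_sq_enorm_inner]

/-- The operator norm of A*A is ‖A‖², which the integrable squared Hilbert-Schmidt norm dominates.
-/
theorem MemH1.integrable_ppGNH (hG : MemH1 μ G D) (V : OrthonormalBasis κ ℝ Y) :
    Integrable (fun m => ppGNH D m) μ := by
  have hcont : Continuous fun T : CMSpace μ →L[ℝ] Y => ContinuousLinearMap.adjoint T ∘L T :=
    (ContinuousLinearMap.adjoint (𝕜 := ℝ) (E := CMSpace μ) (F := Y)).continuous.clm_comp
      continuous_id
  refine ⟨hcont.comp_aestronglyMeasurable hG.aestronglyMeasurable_deriv,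
    lt_of_le_of_lt (lintegral_mono fun m => ?_) hG.lintegral_hsNormSq_lt_top⟩
  refine le_trans (le_of_eq ?_) (sq_enorm_le_hsNormSq V (D m))
  change ‖ContinuousLinearMap.adjoint (D m) ∘L D m‖ₑ = _
  rw [← ofReal_norm, ← ofReal_norm, ContinuousLinearMap.norm_adjoint_comp_self,
    ENNReal.ofReal_mul (norm_nonneg _), sq]

theorem MemH1.aestronglyMeasurable_apply (hG : MemH1 μ G D) (h : CMSpace μ) :
    AEStronglyMeasurable (fun m => D m h) μ :=
  (ContinuousLinearMap.apply ℝ Y h).continuous.comp_aestronglyMeasurable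
    hG.aestronglyMeasurable_deriv

/-- Links the directional energies of the Poincaré inequality to the quadratic form whose trace is
estimated spectrally. -/
theorem MemH1.ofReal_inner_expectedPPGNH (hG : MemH1 μ G D) (V : OrthonormalBasis κ ℝ Y)
    (h : CMSpace μ) :
    ENNReal.ofReal (inner ℝ h (expectedPPGNH μ D h)) = ∫⁻ m, ‖D m h‖ₑ ^ 2 ∂μ := by
  have hint := hG.integrable_ppGNH V
  have h1 : Integrable (fun m => ppGNH D m h) μ := hint.apply_continuousLinearMap h
  have h2 : ∀ m, inner ℝ h (ppGNH D m h) = ‖D m h‖ ^ 2 := fun m => by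
    rw [ppGNH, ContinuousLinearMap.comp_apply, ContinuousLinearMap.adjoint_inner_right,
      real_inner_self_eq_norm_sq]
  have h3 : Integrable (fun m => ‖D m h‖ ^ 2) μ := by
    simp_rw [← h2]
    exact h1.const_inner h
  rw [expectedPPGNH, ContinuousLinearMap.integral_apply hint, ← integral_inner h1]
  simp_rw [h2]
  rw [ofReal_integral_eq_lintegral_ofReal h3 (ae_of_all _ fun _ => sq_nonneg _)]
  refine lintegral_congr fun m => ?_
  rw [ENNReal.ofReal_pow (norm_nonneg _), ofReal_norm]

theorem MemH1.inner_expectedPPGNH_nonneg (hG : MemH1 μ G D) (V : OrthonormalBasis κ ℝ Y)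
    (h : CMSpace μ) : 0 ≤ inner ℝ h (expectedPPGNH μ D h) := by
  have hint := hG.integrable_ppGNH V
  have h1 : Integrable (fun m => ppGNH D m h) μ := hint.apply_continuousLinearMap h
  rw [expectedPPGNH, ContinuousLinearMap.integral_apply hint, ← integral_inner h1]
  refine integral_nonneg fun m => ?_
  rw [ppGNH, ContinuousLinearMap.comp_apply, ContinuousLinearMap.adjoint_inner_right]
  exact real_inner_self_nonneg

theorem MemH1.summable_eigenvalues (hG : MemH1 μ G D) (V : OrthonormalBasis κ ℝ Y)
    {N : ℕ∞} {lam : ℕ → ℝ} {ψ : ℕ → CMSpace μ}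
    (hψ : IsEigensystem (expectedPPGNH μ D) N lam ψ) : Summable lam := by
  refine summable_of_sum_range_le (c := (∫⁻ m, hsNormSq (D m) ∂μ).toReal) hψ.nonneg fun n => ?_
  rw [hψ.sum_range_eq, ← ENNReal.ofReal_le_iff_le_toReal hG.lintegral_hsNormSq_lt_top.ne,
    ENNReal.ofReal_sum_of_nonneg fun _ _ => hG.inner_expectedPPGNH_nonneg V _]
  simp_rw [hG.ofReal_inner_expectedPPGNH V]
  rw [← lintegral_finsetSum' _ fun j _ => (hG.aestronglyMeasurable_apply _).enorm.pow_const 2]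
  exact lintegral_mono fun m => sum_sq_enorm_apply_le_hsNormSq V (D m) hψ.orthonormal _

variable {r : ℕ} {ψ : Fin r → CMSpace μ}

theorem memLp_comp_mixArg (hμ : ∫ m, m ∂μ = 0) (hψ : Orthonormal ℝ ψ) (hG : MemLp G 2 μ) :
    MemLp (fun p : EuclideanSpace ℝ (Fin r) × M => G (mixArg μ ψ p.1 p.2)) 2
      ((stdGaussian (EuclideanSpace ℝ (Fin r))).prod μ) :=
  hG.comp_measurePreserving (measurePreserving_mixArg hμ hψ)

theorem ae_integrable_comp_mixArg (hμ : ∫ m, m ∂μ = 0) (hψ : Orthonormal ℝ ψ)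
    (hG : MemLp G 2 μ) : ∀ᵐ z ∂stdGaussian (EuclideanSpace ℝ (Fin r)),
      Integrable (fun m => G (mixArg μ ψ z m)) μ :=
  ((memLp_comp_mixArg hμ hψ hG).integrable one_le_two).prod_right_ae

/-- The directional Poincaré inequality for the components of a function in `H¹`. -/
theorem MemH1.sq_norm_sub_starProjection_le (hμ : ∫ m, m ∂μ = 0) (hG : MemH1 μ G D) (v : Y)
    (hF : MemLp (fun m => inner ℝ v (G m)) 2 μ) {e : CMSpace μ} (he : ‖e‖ = 1) :
    ENNReal.ofReal (‖hF.toLp _ - (cosOrth μ e).starProjection (hF.toLp _)‖ ^ 2) ≤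
      ∫⁻ m, ‖inner ℝ v (D m e)‖ₑ ^ 2 ∂μ := by
  obtain ⟨G', hG', hAC⟩ := hG.rayAC e
  refine sq_norm_sub_starProjection_cosOrth_le hμ he hF (F' := fun m => inner ℝ v (G' m))
    ((innerSL ℝ v).continuous.comp_aestronglyMeasurable (hG.aestronglyMeasurable_apply e)) ?_ ?_ ?_
  · filter_upwards [hG.deriv e] with m hm
    have := ((innerSL ℝ v).continuous.tendsto _).comp hm
    refine this.congr fun t => ?_
    simp [inner_smul_right, inner_sub_right]
  · filter_upwards [hG'] with m hm
    rw [hm]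
  · exact fun m a b => (innerSL ℝ v).lipschitz.comp_absolutelyContinuousOnInterval (hAC m a b)

/-- The subspace Poincaré inequality: the error of the reduced mapping is at most the trace of the
expected ppGNH on the complement. -/
theorem MemH1.lintegral_sub_reducedMap_le (hμ : ∫ m, m ∂μ = 0) (hG : MemH1 μ G D)
    (V : OrthonormalBasis κ ℝ Y) (hψ : Orthonormal ℝ ψ) {ι : Type*} {e : ι → CMSpace μ}
    (he : Orthonormal ℝ e)
    (hsum : ∀ h : CMSpace μ, HasSum (fun i => inner ℝ (e i) h • e i)
      (h - ∑ j, inner ℝ (ψ j) h • ψ j)) :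
    ∫⁻ m, ‖G m - reducedMap μ G ψ (encoder μ ψ m)‖ₑ ^ 2 ∂μ ≤
      ∑' i, ENNReal.ofReal (inner ℝ (e i) (expectedPPGNH μ D (e i))) := by
  have hF : ∀ a, MemLp (fun m => inner ℝ (V a) (G m)) 2 μ := fun a =>
    hG.memLp.const_inner (V a)
  have hint : ∀ᵐ m ∂μ, Integrable (fun m' => G (mixArg μ ψ (encoder μ ψ m) m')) μ := by
    have h := ae_integrable_comp_mixArg hμ hψ hG.memLp
    rw [← map_encoder hμ hψ] at h
    exact ae_of_ae_map (by fun_prop) h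
  have hred : AEStronglyMeasurable (fun m => reducedMap μ G ψ (encoder μ ψ m)) μ := by
    have h : AEStronglyMeasurable (reducedMap μ G ψ) (μ.map (encoder μ ψ)) := by
      rw [map_encoder hμ hψ]
      exact (memLp_comp_mixArg hμ hψ hG.memLp).1.integral_prod_right'
    exact h.comp_measurable measurable_encoder
  calc ∫⁻ m, ‖G m - reducedMap μ G ψ (encoder μ ψ m)‖ₑ ^ 2 ∂μ
      = ∑ a, ∫⁻ m, ‖inner ℝ (V a) (G m - reducedMap μ G ψ (encoder μ ψ m))‖ₑ ^ 2 ∂μ := by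
        exact (V.sum_lintegral_sq_enorm_inner (hG.memLp.1.sub hred)).symm
    -- The scalar inequality is used for each component; the inner product passes through the
    -- average wherever the latter is integrable.
    _ ≤ ∑ a, ∑' i, ∫⁻ m, ‖inner ℝ (V a) (D m (e i))‖ₑ ^ 2 ∂μ := by
        refine Finset.sum_le_sum fun a _ => ?_
        refine le_of_eq_of_le ?_ (lintegral_sub_reducedMap_le_of_forall_sum_le hμ hψ he hsum (hF a)
          fun i => hG.sq_norm_sub_starProjection_le hμ (V a) (hF a) (he.1 i))
        refine lintegral_congr_ae ?_
        filter_upwards [hint] with m hm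
        rw [inner_sub_right, reducedMap, integral_inner hm]
    _ = ∑' i, ∑ a, ∫⁻ m, ‖inner ℝ (V a) (D m (e i))‖ₑ ^ 2 ∂μ :=
        (Summable.tsum_finsetSum fun _ _ => ENNReal.summable).symm
    _ = _ := by
        congr 1
        funext i
        rw [hG.ofReal_inner_expectedPPGNH V,
          V.sum_lintegral_sq_enorm_inner (hG.aestronglyMeasurable_apply (e i))]

theorem eLpNorm_reducedMap_sub_surrogate {d : ℕ} (hμ : ∫ m, m ∂μ = 0) (hψ : Orthonormal ℝ ψ)
    (hG : MemLp G 2 μ) (V : OrthonormalBasis (Fin d) ℝ Y)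
    {f : EuclideanSpace ℝ (Fin r) → EuclideanSpace ℝ (Fin d)} (hf : Measurable f) :
    eLpNorm (fun m => reducedMap μ G ψ (encoder μ ψ m) - surrogate μ ψ V f m) 2 μ =
      eLpNorm (fun z => f z - V.repr (reducedMap μ G ψ z)) 2
        (stdGaussian (EuclideanSpace ℝ (Fin r))) := by
  have hred : AEStronglyMeasurable (reducedMap μ G ψ) (stdGaussian (EuclideanSpace ℝ (Fin r))) :=
    (memLp_comp_mixArg hμ hψ hG).1.integral_prod_right'
  have hm : AEStronglyMeasurable (fun z => f z - V.repr (reducedMap μ G ψ z))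
      (stdGaussian (EuclideanSpace ℝ (Fin r))) :=
    hf.aestronglyMeasurable.sub (V.repr.continuous.comp_aestronglyMeasurable hred)
  rw [← map_encoder hμ hψ] at hm ⊢
  rw [eLpNorm_map_measure hm (by fun_prop)]
  refine eLpNorm_congr_norm_ae (ae_of_all _ fun m => ?_)
  rw [surrogate, Function.comp_apply, ← V.repr.norm_map (_ - _), map_sub,
    LinearIsometryEquiv.apply_symm_apply, norm_sub_rev]

end Main

end

/-! ### The error bound -/

theorem proposition1
    {M : Type*} [NormedAddCommGroup M] [InnerProductSpace ℝ M] [CompleteSpace M]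
    [SecondCountableTopology M] [MeasurableSpace M] [BorelSpace M]
    -- the prior: a centered Gaussian measure
    (μ : Measure M) [IsGaussian μ] (hμ : ∫ m, m ∂μ = 0)
    -- the noise covariance, which determines the observable space
    {d : ℕ} (Cn : Matrix (Fin d) (Fin d) ℝ) (hCn : Cn.PosDef)
    -- the parameter-to-observable map and its stochastic derivative
    (G : M → ObsSpace Cn hCn) (D : M → CMSpace μ →L[ℝ] ObsSpace Cn hCn) (hG : MemH1 μ G D)
    -- the sample points
    {n : ℕ} (hn : 0 < n) (x : Fin n → M)
    -- the eigenpairs of the expected ppGNH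
    (N : ℕ∞) (lam : ℕ → ℝ) (ψ : ℕ → CMSpace μ)
    (hψ : IsEigensystem (expectedPPGNH μ D) N lam ψ)
    -- the eigenpairs of the sample estimate
    (N' : ℕ∞) (lam' : ℕ → ℝ) (ψ' : ℕ → CMSpace μ)
    (hψ' : IsEigensystem (samplePPGNH D x) N' lam' ψ')
    (r : ℕ) (hr : (r : ℕ∞) ≤ N')
    (V : OrthonormalBasis (Fin d) ℝ (ObsSpace Cn hCn))
    -- the neural network and its weight
    {dw : ℕ}
    (f : EuclideanSpace ℝ (Fin r) → EuclideanSpace ℝ (Fin dw) → EuclideanSpace ℝ (Fin d))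
    (w : EuclideanSpace ℝ (Fin dw)) (hf : Measurable fun z => f z w) :
    Integrable (fun m => ppGNH D m) μ ∧
    Summable lam ∧
    (∀ᵐ z ∂stdGaussian (EuclideanSpace ℝ (Fin r)),
      Integrable (fun m => G (mixArg μ (fun j : Fin r => ψ' j) z m)) μ) ∧
    eLpNorm (fun m => G m - surrogate μ (fun j : Fin r => ψ' j) V (fun z => f z w) m) 2 μ ≤
      eLpNorm (fun z => f z w - V.repr (reducedMap μ G (fun j : Fin r => ψ' j) z)) 2
          (stdGaussian (EuclideanSpace ℝ (Fin r))) +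
        ENNReal.ofReal
          (√((∑' j, lam (r + j)) + 2 * r * ‖expectedPPGNH μ D - samplePPGNH D x‖)) := by
  have hlam := hG.summable_eigenvalues V hψ
  have hon := hψ'.orthonormal_fin hr
  refine ⟨hG.integrable_ppGNH V, hlam, ae_integrable_comp_mixArg hμ hon hG.memLp, ?_⟩
  set φ : Fin r → CMSpace μ := fun j => ψ' j with hφ
  set B := (∑' j, lam (r + j)) + 2 * r * ‖expectedPPGNH μ D - samplePPGNH D x‖ with hB
  obtain ⟨ι, e, he, hsum⟩ := hon.exists_complement_basis
  have heo : Orthonormal ℝ e := he.comp Sum.inr Sum.inr_injective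
  -- The complement basis may be uncountable a priori, so the trace is bounded through its finite
  -- partial sums.
  have hpoinc : ∫⁻ m, ‖G m - reducedMap μ G φ (encoder μ φ m)‖ₑ ^ 2 ∂μ ≤ ENNReal.ofReal B := by
    refine (hG.lintegral_sub_reducedMap_le hμ V hon heo hsum).trans ?_
    rw [ENNReal.tsum_eq_iSup_sum]
    refine iSup_le fun s => ?_
    rw [← ENNReal.ofReal_sum_of_nonneg fun _ _ => hG.inner_expectedPPGNH_nonneg V _]
    exact ENNReal.ofReal_le_ofReal (sum_inner_complement_le hψ hψ' hlam hr he s)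
  have hred : AEStronglyMeasurable (reducedMap μ G φ) (μ.map (encoder μ φ)) := by
    rw [map_encoder hμ hon]
    exact (memLp_comp_mixArg hμ hon hG.memLp).1.integral_prod_right'
  have hred' : AEStronglyMeasurable (fun m => reducedMap μ G φ (encoder μ φ m)) μ :=
    hred.comp_measurable measurable_encoder
  have hsur : AEStronglyMeasurable (surrogate μ φ V fun z => f z w) μ :=
    V.repr.symm.continuous.comp_aestronglyMeasurable
      (hf.comp measurable_encoder).aestronglyMeasurable
  have hsq : eLpNorm (fun m => G m - reducedMap μ G φ (encoder μ φ m)) 2 μ ≤ ENNReal.ofReal √B := by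
    rw [← ENNReal.pow_le_pow_left_iff two_ne_zero, eLpNorm_two_sq,
      ← ENNReal.ofReal_pow (Real.sqrt_nonneg _)]
    refine hpoinc.trans (ENNReal.ofReal_le_ofReal ?_)
    rw [Real.sq_sqrt]
    have : 0 ≤ ∑' j, lam (r + j) := tsum_nonneg fun j => hψ.nonneg (r + j)
    positivity
  calc eLpNorm (fun m => G m - surrogate μ φ V (fun z => f z w) m) 2 μ
      = eLpNorm ((fun m => reducedMap μ G φ (encoder μ φ m) - surrogate μ φ V (fun z => f z w) m) +
          fun m => G m - reducedMap μ G φ (encoder μ φ m)) 2 μ := by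
        congr 1
        funext m
        simp only [Pi.add_apply]
        abel
    _ ≤ _ := eLpNorm_add_le (hred'.sub hsur) (hG.memLp.1.sub hred') one_le_two
    _ ≤ _ := by
        rw [eLpNorm_reducedMap_sub_surrogate hμ hon hG.memLp V hf]
        gcongr
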